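/- **Setting.** Let $n\ge 1$, and let $C$ be a concept class over $\{0,1\}^n$, i.e. a set of functions $c:\{0,1\}^n\to\{0,1\}$, with $|C|\ge 2$. The quantum membership oracle of $c$ is the unitary $QMQ_c:|x,b\rangle\mapsto|x,b\oplus c(x)\rangle$. A $T$-query quantum exact learning algorithm for $C$ is a sequence $U_0,QMQ_c,U_1,\dots,QMQ_c,U_T$ with unitaries $U_i$ (on the query register and a finite work space) that do not depend on $c$, started in a fixed basis state, such that for every target $c\in C$ the measurement of the final state yields, with probability at least $2/3$, a hypothesis equal to $c$. $Q(C)$ is the least such $T$. Logarithms are to base 2. A *column flip* of a set $S$ of concepts on a set $K$ of inputs inverts the values of all concepts of $S$ at the inputs in $K$; $S$ is *1-sensitive* if at every input at least half of its concepts have value $0$. Flipping exactly the inputs at which more concepts of $S$ have value $1$ than $0$ makes $S$ 1-sensitive. **Choice of inputs.** For a set $S$ of concepts, $\mathcal I(S)$ is built greedily, from $\mathcal I=R=\emptyset$: repeat: among the inputs outside $\mathcal I$ choose $a$ at which the highest fraction of the concepts in $S\setminus R$, after the column flip that makes $S\setminus R$ 1-sensitive, have value $1$; add $a$ to $\mathcal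 I$, and add to $R$ all concepts of $S$ with (unflipped) value $1$ at $a$; until $|R|\ge|S|/2$. **Grover search on $\mathcal I$.** With $m=\lceil\sqrt{|\mathcal I|}\rceil$ and a budget of $\frac92 m$ queries, repeat rounds until a target is found or the next round exceeds the budget: draw $j\in\{0,\dots,m-1\}$ uniformly, apply $j$ Grover iterations (one oracle query each) to the uniform superposition over $\mathcal I$, measure, and check the outcome with one more query. The result is the last outcome. **The learning algorithm.** Start with $S=C$ and repeat the following until $|S|=1$, then output the sole concept of $S$. Let $K$ be the set of inputs flipped to make $S$ 1-sensitive; flip $S$ and the oracle on $K$; put $\mathcal I=\mathcal I(S)$ for the flipped $S$. At most $\lceil\log(3\log|C|)\rceil$ times, run the Grover search on $\mathcal I$ and query the oracle classically at the returned input $a$; if the answer is $1$, replace $S$ by the set of its concepts with value $1$ at $a$ and leave this inner loop. If no answer is $1$, replace $S$ by the set of its concepts with value $0$ on all of $\mathcal I$. Undo the flip of $S$ on $K$. **Corollary.** There is an absolute constant $K_0>0$ such that for all $n\ge1$, all concept classes $C$ over $\{0,1\}^n$ with $|C|\ge2$ and all targets $c\in C$: the learning algorithm always halts with $|S|=1$,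 outputs $c$ with probability at least $2/3$, and in every run makes at most $$K_0\, n\,Q(C)^2\,\max\{1,\log\log|C|\}$$ queries, i.e. $O(n\,Q(C)^2\log\log|C|)$ queries for $|C|\ge3$. Its number of queries is also at most $K_0\,n^2\,Q(C)^2$; so it is within a roughly quadratic factor of the optimum $Q(C)$. -/

import Mathlib

open scoped ENNReal

noncomputable section

namespace QuantumLearning

/-- Inputs `x ∈ {0,1}ⁿ`. -/
abbrev BitString (n : ℕ) : Type := Fin n → Bool

/-- A concept over `{0,1}ⁿ`; a concept class over `{0,1}ⁿ` is a `Finset (Concept n)`. -/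
abbrev Concept (n : ℕ) : Type := BitString n → Bool

/-! ### Quantum membership queries and the complexity `Q(C)` -/

/-- Computational basis states `|x, b, w⟩`: an input, an answer bit and a work space. -/
abbrev Basis (n : ℕ) (W : Type) : Type := BitString n × Bool × W

/-- The map `|x, b, w⟩ ↦ |x, b ⊕ c(x), w⟩` on basis states. -/
def oraclePerm {n : ℕ} (W : Type) (c : Concept n) : Equiv.Perm (Basis n W) where
  toFun s := (s.1, xor s.2.1 (c s.1), s.2.2)
  invFun s := (s.1, xor s.2.1 (c s.1), s.2.2)
  left_inv s := by simp
  right_inv s := by simp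

/-- The quantum membership oracle `QMQ_c`. -/
def oracle {n : ℕ} (W : Type) [Fintype W] (c : Concept n) :
    EuclideanSpace ℂ (Basis n W) ≃ₗᵢ[ℂ] EuclideanSpace ℂ (Basis n W) :=
  LinearIsometryEquiv.piLpCongrLeft 2 ℂ ℂ (oraclePerm W c)

/-- The ingredients of a quantum query algorithm: a finite work space, unitaries `U₀, U₁, …` that
do not depend on the target concept (a `T`-query algorithm uses `U₀, …, U_T`), and the hypothesis
that is read off from the outcome of the final measurement. -/
structure QuantumAlgorithm (n : ℕ) where
  workDim : ℕ
  unitary : ℕ → (EuclideanSpace ℂ (Basis n (Fin (workDim + 1))) ≃ₗᵢ[ℂ]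
    EuclideanSpace ℂ (Basis n (Fin (workDim + 1))))
  hypothesis : Basis n (Fin (workDim + 1)) → Concept n

/-- The state `U_T QMQ_c U_{T-1} ⋯ U₁ QMQ_c U₀ |0⟩`. -/
def QuantumAlgorithm.state {n : ℕ} (A : QuantumAlgorithm n) (c : Concept n) :
    ℕ → EuclideanSpace ℂ (Basis n (Fin (A.workDim + 1)))
  | 0 => A.unitary 0 (EuclideanSpace.single (fun _ => false, false, 0) 1)
  | T + 1 => A.unitary (T + 1) (oracle _ c (A.state c T))

/-- The probability that the measurement after `T` queries yields a hypothesis equal to `c`. -/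
def QuantumAlgorithm.successProb {n : ℕ} (A : QuantumAlgorithm n) (T : ℕ) (c : Concept n) : ℝ :=
  ∑ s : Basis n (Fin (A.workDim + 1)), if A.hypothesis s = c then ‖A.state c T s‖ ^ 2 else 0

/-- `A`, run with `T` queries, is a quantum exact learning algorithm for `C`. -/
def QuantumAlgorithm.ExactlyLearns {n : ℕ} (A : QuantumAlgorithm n) (T : ℕ)
    (C : Finset (Concept n)) : Prop :=
  ∀ c ∈ C, 2 / 3 ≤ A.successProb T c

/-- `Q(C)`: the least number of queries of a quantum exact learning algorithm for `C`. -/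
def quantumQueryComplexity {n : ℕ} (C : Finset (Concept n)) : ℕ :=
  sInf {T | ∃ A : QuantumAlgorithm n, A.ExactlyLearns T C}

/-! ### Column flips and sets of inputs with the semi-rich row condition -/

/-- The number of concepts of `S` with value `1` at `x`. -/
def onesAt {n : ℕ} (S : Finset (Concept n)) (x : BitString n) : ℕ :=
  (S.filter (fun c => c x = true)).card

/-- The number of concepts of `S` with value `0` at `x`. -/
def zerosAt {n : ℕ} (S : Finset (Concept n)) (x : BitString n) : ℕ :=
  (S.filter (fun c => c x = false)).card

/-- The inputs whose columns are flipped to make `S` 1-sensitive. -/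
def flipSet {n : ℕ} (S : Finset (Concept n)) : Finset (BitString n) :=
  Finset.univ.filter (fun x => zerosAt S x < onesAt S x)

/-- The concept `c` with its values at the inputs in `K` inverted. -/
def flipConcept {n : ℕ} (K : Finset (BitString n)) (c : Concept n) : Concept n :=
  fun x => xor (c x) (decide (x ∈ K))

/-- The column flip of `S` on the set of columns `K`. -/
def columnFlip {n : ℕ} (K : Finset (BitString n)) (S : Finset (Concept n)) :
    Finset (Concept n) :=
  S.image (flipConcept K)

/-- An input outside `I` at which the highest fraction of the concepts of `D` has value `1`
(ties are broken by choice). -/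
def bestInput {n : ℕ} (D : Finset (Concept n)) (I : Finset (BitString n)) (h : Iᶜ.Nonempty) :
    BitString n :=
  (Finset.exists_max_image Iᶜ (onesAt D) h).choose

theorem bestInput_notMem {n : ℕ} (D : Finset (Concept n)) (I : Finset (BitString n))
    (h : Iᶜ.Nonempty) : bestInput D I h ∉ I :=
  Finset.mem_compl.1 (Finset.exists_max_image Iᶜ (onesAt D) h).choose_spec.1

/-- The greedy loop: `S` is the set of concepts of `C` that are already covered. -/
def semiRichLoop {n : ℕ} (C S : Finset (Concept n)) (I : Finset (BitString n)) :
    Finset (BitString n) :=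
  if h : Iᶜ.Nonempty then
    let D := columnFlip (flipSet (C \ S)) (C \ S)
    let a := bestInput D I h
    let S' := S ∪ C.filter (fun c => c a = true)
    if C.card ≤ 2 * S'.card then insert a I else semiRichLoop C S' (insert a I)
  else I
termination_by Iᶜ.card
decreasing_by
  refine Finset.card_lt_card ?_
  rw [Finset.compl_ssubset_compl]
  exact Finset.ssubset_insert (bestInput_notMem _ _ _)

/-- The greedy construction of a set of inputs that satisfies the semi-rich row condition. -/
def semiRichInputs {n : ℕ} (C : Finset (Concept n)) : Finset (BitString n) :=
  semiRichLoop C ∅ ∅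

/-! ### Multi-target Grover search on a subset of the inputs -/

theorem sum_born {ι : Type} [Fintype ι] (ψ : EuclideanSpace ℂ ι) (h : ‖ψ‖ = 1) :
    ∑ i, ENNReal.ofReal (‖ψ i‖ ^ 2) = 1 := by
  rw [← ENNReal.ofReal_sum_of_nonneg (fun i _ => sq_nonneg _), ← EuclideanSpace.norm_sq_eq, h]
  simp

/-- The outcome of a measurement of the unit vector `ψ` in the computational basis (Born rule).
The value at vectors that are not unit vectors is irrelevant. -/
def measure {ι : Type} [Fintype ι] [Nonempty ι] (ψ : EuclideanSpace ℂ ι) : PMF ι :=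
  open Classical in
  if h : ‖ψ‖ = 1 then PMF.ofFintype (fun i => ENNReal.ofReal (‖ψ i‖ ^ 2)) (sum_born ψ h)
  else PMF.pure (Classical.arbitrary ι)

/-- The state `|I|^(-1/2) ∑_{x ∈ I} |x⟩ ⊗ 2^(-1/2) (|0⟩ - |1⟩)`. -/
def groverStart {n : ℕ} (I : Finset (BitString n)) : EuclideanSpace ℂ (Basis n Unit) :=
  WithLp.toLp 2 (fun s =>
    if s.1 ∈ I then (if s.2.1 then -1 else 1) / (Real.sqrt (2 * (I.card : ℝ)) : ℂ) else 0)

/-- One Grover iteration: one oracle query, then the reflection `2|s⟩⟨s| - 1` in the starting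
state `|s⟩`. -/
def groverIteration {n : ℕ} (c : Concept n) (I : Finset (BitString n))
    (ψ : EuclideanSpace ℂ (Basis n Unit)) : EuclideanSpace ℂ (Basis n Unit) :=
  (Submodule.span ℂ {groverStart I}).reflection (oracle Unit c ψ)

/-- The measured input register after `j` Grover iterations. -/
def groverSample {n : ℕ} (c : Concept n) (I : Finset (BitString n)) (j : ℕ) :
    PMF (BitString n) :=
  (measure ((groverIteration c I)^[j] (groverStart I))).map Prod.fst

/-- `⌈√|I|⌉`. -/
def ceilSqrtCard {n : ℕ} (I : Finset (BitString n)) : ℕ := ⌈Real.sqrt (I.card : ℝ)⌉₊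

/-- Grover search on `I` for an unknown number of targets, with `budget` queries left and last
measurement outcome `last`. A round draws `j < ⌈√|I|⌉` uniformly (the `max 1` only matters for the
empty set), performs `j` Grover iterations, measures, and checks the outcome with one more query.
Rounds are repeated until a target is found or the next round exceeds the budget. The result is
the last measured input together with the number of queries made. -/
def groverLoop {n : ℕ} (c : Concept n) (I : Finset (BitString n)) (budget : ℕ)
    (last : BitString n) : PMF (BitString n × ℕ) :=
  (PMF.uniformOfFinset (Finset.range (max 1 (ceilSqrtCard I))) ⟨0, by simp⟩).bind fun j =>
    if _h : j + 1 ≤ budget then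
      (groverSample c I j).bind fun a =>
        if c a = true then PMF.pure (a, j + 1)
        else (groverLoop c I (budget - (j + 1)) a).map fun r => (r.1, r.2 + (j + 1))
    else PMF.pure (last, 0)
termination_by budget

/-- Multi-target Grover search on `I` with at most `(9/2)⌈√|I|⌉` queries. (The first round is
always within the budget, so that the initial value of `last` is never returned for `I ≠ ∅`.) -/
def subsetGrover {n : ℕ} (c : Concept n) (I : Finset (BitString n)) : PMF (BitString n × ℕ) :=
  groverLoop c I (9 * ceilSqrtCard I / 2) (fun _ => false)

/-! ### The learning algorithm -/

/-- The inner loop with at most `r` repetitions: a Grover search, then a classical query at the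
input it returned. The result is an input with value `1`, if one was found, together with the
number of queries made. -/
def innerLoop {n : ℕ} (c : Concept n) (I : Finset (BitString n)) :
    ℕ → PMF (Option (BitString n) × ℕ)
  | 0 => PMF.pure (none, 0)
  | r + 1 => (subsetGrover c I).bind fun p =>
      if c p.1 = true then PMF.pure (some p.1, p.2 + 1)
      else (innerLoop c I r).map fun s => (s.1, s.2 + (p.2 + 1))

/-- The number of repetitions after which the inner loop gives up: the first integer that is at
least `log₂ (3 log₂ |C|)`. -/
def innerRounds {n : ℕ} (C : Finset (Concept n)) : ℕ :=
  ⌈Real.logb 2 (3 * Real.logb 2 (C.card : ℝ))⌉₊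

/-- One pass of the outer loop for the class `C` and the target concept `c`. The state consists of
the set of remaining candidates and the number of queries made so far; a state with exactly one
candidate is final. -/
def outerStep {n : ℕ} (C : Finset (Concept n)) (c : Concept n) (st : Finset (Concept n) × ℕ) :
    PMF (Finset (Concept n) × ℕ) :=
  if st.1.card = 1 then PMF.pure st
  else
    let K := flipSet st.1
    let S := columnFlip K st.1
    let I := semiRichInputs S
    (innerLoop (flipConcept K c) I (innerRounds C)).map fun r =>
      (match r.1 with
        | some a => columnFlip K (S.filter (fun d => d a = true))
        | none => columnFlip K (S.filter (fun d => ∀ x ∈ I, d x = false)),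
       st.2 + r.2)

/-- The state after `k` passes of the outer loop. -/
def outerLoop {n : ℕ} (C : Finset (Concept n)) (c : Concept n) :
    ℕ → PMF (Finset (Concept n) × ℕ)
  | 0 => PMF.pure (C, 0)
  | k + 1 => (outerLoop C c k).bind (outerStep C c)

/-- The quantum exact learning algorithm for the class `C`, run on the target concept `c`: the
joint distribution of the final set of candidates and of the number of queries made. Final states
do not change any more, so that `|C|` passes amount to the unbounded loop as soon as every run has
reached a final state by then. -/
def learner {n : ℕ} (C : Finset (Concept n)) (c : Concept n) : PMF (Finset (Concept n) × ℕ) :=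
  outerLoop C c C.card

end QuantumLearning

end

/-!
Let `T = Q(C)` and fix a learner that attains it; one exists because all `2 ^ n` inputs can be
queried (`exists_exactlyLearns`), so that `Q(C)` is not the junk value of an infimum over the empty
set. The number of queries of the learning algorithm is compared with `T` through two lower bounds
for `T`.

* Counting (`QuantumAlgorithm.card_le_of_exactlyLearns`). An oracle is a sum over the inputs `x` of
  maps that depend only on `x` and `c x`, so all states reachable with `T` queries lie in a space of
  dimension at most `2 ^ ((n + 1) T)`. This dimension bounds the sum of the success probabilities
  over all targets, whence `log |C| ≤ 3 n T`.
* Hybrid argument (`QuantumAlgorithm.exists_card_le_minority`). If at every input only a small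
  fraction of a subclass `D` deviates from the majority, then replacing the target by the majority
  hardly changes the final state, so that one state would have to announce several concepts.
  Hence some input has at least `|D| / (336 T²)` concepts of `D` on both sides. By this, each step
  of the greedy construction covers the fraction `1 / (336 T²)` of the remaining concepts, and
  the chosen set `I` has at most `336 T²` elements (`isSemiRich_semiRichLoop`).

Each pass at least halves the set of candidates, whatever its outcome: a column has at most half
ones after the flip, and at least half of the concepts have value `1` somewhere on `I`. It also
leaves at least one candidate, even if the target has been lost. So there are at most `log |C|`
passes, each with `O(log log |C|)` searches of cost `O(√|I|) = O(T)`
(`mem_support_outerLoop`). Finally `log log |C| ≤ n`.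

For the success probability, the states of the Grover search stay in the plane of the vectors
`groverVec c I a b`, where an iteration is a rotation. Averaged over the number of iterations, a
round misses the targets with probability at most `3/4` (`sum_expect_groverSample_miss_le`). Every
round costs at most `⌈√|I|⌉` queries, so the budget suffices for four rounds, and a search fails
with probability at most `(3/4) ^ 4 < 1/2`. A pass loses the target only if all its
`⌈log (3 log |C|)⌉` searches fail, hence with probability at most `δ ≤ 1 / (3 log |C|)`. The
potential `failurePotential`, which charges `δ` for each halving still possible, is a
supermartingale, and it bounds the total failure probability by `δ log |C| ≤ 1/3`.
-/

namespace QuantumLearning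

/-! ### States of a query algorithm -/

theorem oracle_apply {n : ℕ} {W : Type} [Fintype W] (c : Concept n)
    (ψ : EuclideanSpace ℂ (Basis n W)) (x : BitString n) (b : Bool) (w : W) :
    oracle W c ψ (x, b, w) = ψ (x, xor b (c x), w) := rfl

namespace QuantumAlgorithm

variable {n : ℕ} (A : QuantumAlgorithm n)

theorem norm_state (c : Concept n) (T : ℕ) : ‖A.state c T‖ = 1 := by
  induction T with
  | zero => simp [state]
  | succ T ih => simp [state, ih]

/-! ### Counting bound: few queries reach few concepts -/

/-- The part of an oracle call at the single input `p.1` when the concept has the value `p.2`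
there. Every oracle is a sum of such maps, one for each input. -/
def localQuery (W : Type) (p : BitString n × Bool) :
    EuclideanSpace ℂ (Basis n W) →ₗ[ℂ] EuclideanSpace ℂ (Basis n W) where
  toFun ψ := WithLp.toLp 2 fun s => if s.1 = p.1 then ψ (s.1, xor s.2.1 p.2, s.2.2) else 0
  map_add' ψ φ := by
    ext s
    by_cases h : s.1 = p.1 <;> simp [h]
  map_smul' a ψ := by
    ext s
    by_cases h : s.1 = p.1 <;> simp [h]

theorem oracle_eq_sum_localQuery {W : Type} [Fintype W] (c : Concept n)
    (ψ : EuclideanSpace ℂ (Basis n W)) :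
    oracle W c ψ = ∑ x, localQuery W (x, c x) ψ := by
  ext ⟨y, b, w⟩
  simp [oracle_apply, localQuery]

/-- After `T` queries the states for all possible oracles lie in a common space that is spanned by
at most `(2 ^ (n + 1)) ^ T` vectors, since each query multiplies the number of spanning vectors by
at most the number of pairs `(x, c x)`. -/
theorem exists_span_state (T : ℕ) :
    ∃ F : Finset (EuclideanSpace ℂ (Basis n (Fin (A.workDim + 1)))),
      F.card ≤ (2 ^ (n + 1)) ^ T ∧
        ∀ c, A.state c T ∈ Submodule.span ℂ (F : Set (EuclideanSpace ℂ _)) := by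
  classical
  induction T with
  | zero =>
    refine ⟨{A.unitary 0 (EuclideanSpace.single (fun _ => false, false, 0) 1)}, by simp, ?_⟩
    intro c
    exact Submodule.subset_span (by simp [state])
  | succ T ih =>
    obtain ⟨F, hF, hspan⟩ := ih
    let f : BitString n × Bool → EuclideanSpace ℂ (Basis n (Fin (A.workDim + 1))) →ₗ[ℂ]
        EuclideanSpace ℂ (Basis n (Fin (A.workDim + 1))) :=
      fun p => (A.unitary (T + 1)).toLinearEquiv.toLinearMap ∘ₗ localQuery _ p
    refine ⟨Finset.image₂ (fun p v => f p v) Finset.univ F, ?_, ?_⟩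
    · refine (Finset.card_image₂_le _ _ _).trans ?_
      have h : (Finset.univ : Finset (BitString n × Bool)).card = 2 ^ (n + 1) := by
        simp [pow_succ]
      rw [h, pow_succ, mul_comm]
      exact Nat.mul_le_mul_right _ hF
    · intro c
      have h : A.state c (T + 1) = ∑ x, f (x, c x) (A.state c T) := by
        rw [state, oracle_eq_sum_localQuery, map_sum]
        rfl
      rw [h]
      refine Submodule.sum_mem _ fun x _ => ?_
      have h1 := Submodule.mem_map_of_mem (f := f (x, c x)) (hspan c)
      rw [Submodule.map_span] at h1
      refine Submodule.span_mono ?_ h1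
      rintro _ ⟨v, hv, rfl⟩
      exact Finset.mem_coe.2 (Finset.mem_image₂_of_mem (Finset.mem_univ _) hv)

/-- If unit vectors of a subspace `V` are measured in the computational basis, one pairwise disjoint
event `{s | g s = c}` for each vector `ψ c`, then the probabilities of these events sum to at most
`dim V`: each outcome `s` has probability at most `∑ₖ |eₖ(s)|²` for an orthonormal basis `e` of
`V`. -/
theorem sum_detection_le_finrank {ι κ : Type} [Fintype ι] [DecidableEq κ]
    (V : Submodule ℂ (EuclideanSpace ℂ ι)) (D : Finset κ) (g : ι → κ)
    (ψ : κ → EuclideanSpace ℂ ι) (hψ : ∀ c, ‖ψ c‖ = 1) (hV : ∀ c, ψ c ∈ V) :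
    ∑ c ∈ D, ∑ s, (if g s = c then ‖ψ c s‖ ^ 2 else 0) ≤ Module.finrank ℂ V := by
  let e := stdOrthonormalBasis ℂ V
  have key : ∀ c s, ‖ψ c s‖ ^ 2 ≤ ∑ k, ‖(e k : EuclideanSpace ℂ ι) s‖ ^ 2 := by
    intro c s
    let v : V := ⟨ψ c, hV c⟩
    have h1 : ψ c s = ∑ k, inner ℂ (e k) v * (e k : EuclideanSpace ℂ ι) s := by
      have h := congrArg (fun u : V => (u : EuclideanSpace ℂ ι) s) (e.sum_repr' v)
      simpa [v] using h.symm
    have h2 : ∑ k, ‖inner ℂ (e k) v‖ ^ 2 = 1 := by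
      rw [e.sum_sq_norm_inner_right]
      have : ‖v‖ = 1 := hψ c
      rw [this]; norm_num
    have h3 : ‖ψ c s‖ ≤ ∑ k, ‖inner ℂ (e k) v‖ * ‖(e k : EuclideanSpace ℂ ι) s‖ := by
      rw [h1]
      refine (norm_sum_le _ _).trans (le_of_eq ?_)
      simp
    calc ‖ψ c s‖ ^ 2 ≤ (∑ k, ‖inner ℂ (e k) v‖ * ‖(e k : EuclideanSpace ℂ ι) s‖) ^ 2 := by
          gcongr
      _ ≤ (∑ k, ‖inner ℂ (e k) v‖ ^ 2) * ∑ k, ‖(e k : EuclideanSpace ℂ ι) s‖ ^ 2 :=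
          Finset.sum_mul_sq_le_sq_mul_sq _ _ _
      _ = _ := by rw [h2, one_mul]
  calc ∑ c ∈ D, ∑ s, (if g s = c then ‖ψ c s‖ ^ 2 else 0)
      ≤ ∑ c ∈ D, ∑ s, (if g s = c then ∑ k, ‖(e k : EuclideanSpace ℂ ι) s‖ ^ 2 else 0) := by
        refine Finset.sum_le_sum fun c _ => Finset.sum_le_sum fun s _ => ?_
        split_ifs
        · exact key c s
        · exact le_rfl
    _ = ∑ s, ∑ c ∈ D, (if g s = c then ∑ k, ‖(e k : EuclideanSpace ℂ ι) s‖ ^ 2 else 0) :=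
        Finset.sum_comm
    _ ≤ ∑ s, ∑ k, ‖(e k : EuclideanSpace ℂ ι) s‖ ^ 2 := by
        refine Finset.sum_le_sum fun s _ => ?_
        rw [Finset.sum_ite_eq]
        split_ifs
        · exact le_rfl
        · positivity
    _ = ∑ k, ∑ s, ‖(e k : EuclideanSpace ℂ ι) s‖ ^ 2 := Finset.sum_comm
    _ = ∑ k : Fin (Module.finrank ℂ V), (1 : ℝ) := by
        refine Finset.sum_congr rfl fun k _ => ?_
        rw [← EuclideanSpace.norm_sq_eq]
        have : ‖(e k : EuclideanSpace ℂ ι)‖ = 1 := e.norm_eq_one k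
        rw [this]; norm_num
    _ = Module.finrank ℂ V := by simp

theorem card_le_of_exactlyLearns {T : ℕ} {C : Finset (Concept n)} (h : A.ExactlyLearns T C) :
    2 / 3 * (C.card : ℝ) ≤ ((2 ^ (n + 1)) ^ T : ℕ) := by
  obtain ⟨F, hF, hspan⟩ := A.exists_span_state T
  have h1 : 2 / 3 * (C.card : ℝ) ≤ ∑ c ∈ C, A.successProb T c := by
    have := Finset.card_nsmul_le_sum C (fun c => A.successProb T c) (2 / 3) h
    simpa [mul_comm] using this
  have h2 := sum_detection_le_finrank _ C A.hypothesis (fun c => A.state c T)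
    (fun c => A.norm_state c T) hspan
  have h3 := finrank_span_finset_le_card (R := ℂ) F
  exact h1.trans (h2.trans (by exact_mod_cast h3.trans hF))

/-! ### Hybrid bound: no subclass is hard to split -/

/-- The squared norm of the component of `ψ` that queries the input `x`. -/
noncomputable def queryMass {W : Type} [Fintype W] (ψ : EuclideanSpace ℂ (Basis n W))
    (x : BitString n) : ℝ :=
  ∑ p : Bool × W, ‖ψ (x, p)‖ ^ 2

theorem sum_queryMass {W : Type} [Fintype W] (ψ : EuclideanSpace ℂ (Basis n W)) :
    ∑ x, queryMass ψ x = ‖ψ‖ ^ 2 := by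
  rw [EuclideanSpace.norm_sq_eq, Fintype.sum_prod_type]
  rfl

theorem norm_oracle_sub_oracle_sq_le {W : Type} [Fintype W] (c m : Concept n)
    (ψ : EuclideanSpace ℂ (Basis n W)) :
    ‖oracle W c ψ - oracle W m ψ‖ ^ 2 ≤ 4 * ∑ x, if c x ≠ m x then queryMass ψ x else 0 := by
  rw [EuclideanSpace.norm_sq_eq, Fintype.sum_prod_type, Finset.mul_sum]
  refine Finset.sum_le_sum fun x _ => ?_
  by_cases h : c x = m x
  · have h1 : ∀ p : Bool × W, (oracle W c ψ - oracle W m ψ) (x, p) = 0 := by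
      rintro ⟨b, w⟩
      rw [PiLp.sub_apply, oracle_apply, oracle_apply, h, sub_self]
    simp [h1, h]
  · rw [if_pos h, queryMass, Fintype.sum_prod_type, Fintype.sum_prod_type, Fintype.sum_bool,
      Fintype.sum_bool, ← Finset.sum_add_distrib, ← Finset.sum_add_distrib, Finset.mul_sum]
    refine Finset.sum_le_sum fun w _ => ?_
    have key : ∀ u v : ℂ, ‖u - v‖ ^ 2 ≤ 2 * (‖u‖ ^ 2 + ‖v‖ ^ 2) := by
      intro u v
      have h1 := norm_sub_le u v
      have h2 := norm_nonneg (u - v)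
      nlinarith [sq_nonneg (‖u‖ - ‖v‖)]
    have h1 := key (ψ (x, true, w)) (ψ (x, false, w))
    have h2 := key (ψ (x, false, w)) (ψ (x, true, w))
    have h3 : c x = !m x := by cases hc : c x <;> cases hm : m x <;> simp_all
    simp only [PiLp.sub_apply, oracle_apply, h3]
    cases m x <;> simp only [Bool.not_true, Bool.not_false, Bool.xor_true, Bool.xor_false] <;>
      linarith

theorem norm_state_sub_state_le (c m : Concept n) (T : ℕ) :
    ‖A.state c T - A.state m T‖ ≤
      ∑ t ∈ Finset.range T, ‖oracle _ c (A.state m t) - oracle _ m (A.state m t)‖ := by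
  induction T with
  | zero => simp [state]
  | succ T ih =>
    rw [Finset.sum_range_succ, state, state, ← map_sub, LinearIsometryEquiv.norm_map]
    have h : oracle _ c (A.state c T) - oracle _ m (A.state m T) =
        oracle _ c (A.state c T - A.state m T) +
          (oracle _ c (A.state m T) - oracle _ m (A.state m T)) := by
      rw [map_sub]; abel
    rw [h]
    refine (norm_add_le _ _).trans ?_
    rw [LinearIsometryEquiv.norm_map]
    linarith

end QuantumAlgorithm

/-- The number of concepts of `D` in the minority at the input `x`. -/
def minority {n : ℕ} (D : Finset (Concept n)) (x : BitString n) : ℕ :=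
  min (onesAt D x) (zerosAt D x)

theorem onesAt_add_zerosAt {n : ℕ} (D : Finset (Concept n)) (x : BitString n) :
    onesAt D x + zerosAt D x = D.card := by
  rw [onesAt, zerosAt, ← Finset.card_filter_add_card_filter_not (s := D) (fun c => c x = true)]
  simp

/-- The pointwise majority of the concepts of `D`; it need not belong to `D`. -/
def majority {n : ℕ} (D : Finset (Concept n)) : Concept n :=
  fun x => decide (zerosAt D x < onesAt D x)

theorem card_filter_ne_majority {n : ℕ} (D : Finset (Concept n)) (x : BitString n) :
    (D.filter fun c => c x ≠ majority D x).card = minority D x := by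
  unfold majority minority
  by_cases h : zerosAt D x < onesAt D x
  · rw [min_eq_right h.le]
    simp only [h, decide_true, ne_eq, Bool.not_eq_true]
    rfl
  · rw [min_eq_left (not_lt.1 h)]
    simp only [h, decide_false, ne_eq, Bool.not_eq_false]
    rfl

namespace QuantumAlgorithm

variable {n : ℕ} (A : QuantumAlgorithm n)

/-- If at each input at most `M` concepts of `D` deviate from the majority, then the final states
for the concepts of `D` are on average close to the final state for the majority. -/
theorem sum_norm_state_sub_majority_le (D : Finset (Concept n)) (T M : ℕ)
    (hM : ∀ x, minority D x ≤ M) :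
    ∑ c ∈ D, ‖A.state c T - A.state (majority D) T‖ ^ 2 ≤ 4 * (T : ℝ) ^ 2 * M := by
  set m := majority D
  have h1 : ∀ c ∈ D, ‖A.state c T - A.state m T‖ ^ 2 ≤
      T * ∑ t ∈ Finset.range T,
        4 * ∑ x, if c x ≠ m x then queryMass (A.state m t) x else 0 := by
    intro c _
    calc ‖A.state c T - A.state m T‖ ^ 2
        ≤ (∑ t ∈ Finset.range T,
            ‖oracle _ c (A.state m t) - oracle _ m (A.state m t)‖) ^ 2 := by
          gcongr
          exact A.norm_state_sub_state_le c m T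
      _ ≤ T * ∑ t ∈ Finset.range T,
            ‖oracle _ c (A.state m t) - oracle _ m (A.state m t)‖ ^ 2 := by
          simpa using sq_sum_le_card_mul_sum_sq (s := Finset.range T)
            (f := fun t => ‖oracle _ c (A.state m t) - oracle _ m (A.state m t)‖)
      _ ≤ _ := by
          gcongr
          exact norm_oracle_sub_oracle_sq_le _ _ _
  have h2 : ∀ t, ∑ c ∈ D, ∑ x, (if c x ≠ m x then queryMass (A.state m t) x else 0) ≤ M := by
    intro t
    rw [Finset.sum_comm]
    calc ∑ x, ∑ c ∈ D, (if c x ≠ m x then queryMass (A.state m t) x else 0)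
        = ∑ x, (minority D x : ℝ) * queryMass (A.state m t) x := by
          refine Finset.sum_congr rfl fun x _ => ?_
          rw [← Finset.sum_filter, Finset.sum_const, card_filter_ne_majority, nsmul_eq_mul]
      _ ≤ ∑ x, (M : ℝ) * queryMass (A.state m t) x := by
          refine Finset.sum_le_sum fun x _ => ?_
          refine mul_le_mul_of_nonneg_right (by exact_mod_cast hM x) ?_
          exact Finset.sum_nonneg fun _ _ => sq_nonneg _
      _ = M := by rw [← Finset.mul_sum, sum_queryMass, A.norm_state]; ring
  calc ∑ c ∈ D, ‖A.state c T - A.state m T‖ ^ 2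
      ≤ ∑ c ∈ D, T * ∑ t ∈ Finset.range T,
          4 * ∑ x, (if c x ≠ m x then queryMass (A.state m t) x else 0) := Finset.sum_le_sum h1
    _ = T * ∑ t ∈ Finset.range T,
          4 * ∑ c ∈ D, ∑ x, (if c x ≠ m x then queryMass (A.state m t) x else 0) := by
        rw [← Finset.mul_sum, Finset.sum_comm]
        simp_rw [← Finset.mul_sum]
    _ ≤ T * ∑ t ∈ Finset.range T, 4 * (M : ℝ) := by
        gcongr
        exact h2 _
    _ = _ := by simp; ring

/-- An exact learner with `T` queries forces every subclass with at least two concepts to be split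
by some input into parts that both have a fraction of order at least `1 / T ^ 2`: otherwise the
final states for the subclass all stay close to that for its majority, and one state cannot
announce two different concepts. -/
theorem exists_card_le_minority {T : ℕ} {C D : Finset (Concept n)} (h : A.ExactlyLearns T C)
    (hDC : D ⊆ C) (hD : 2 ≤ D.card) : ∃ x, D.card ≤ 336 * T ^ 2 * minority D x := by
  obtain ⟨x, -, hx⟩ := Finset.exists_max_image Finset.univ (minority D)
    ⟨fun _ => false, Finset.mem_univ _⟩
  refine ⟨x, ?_⟩
  set φ := A.state (majority D) T
  have h1 := A.sum_norm_state_sub_majority_le D T _ fun y => hx y (Finset.mem_univ y)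
  -- the weights `7/6` and `7` come from `(a + b)² ≤ (1 + ε) a² + (1 + 1/ε) b²` with `ε = 1/6`
  have h2 : ∀ c ∈ D, 2 / 3 ≤ 7 / 6 * (∑ s, if A.hypothesis s = c then ‖φ s‖ ^ 2 else 0) +
      7 * ‖A.state c T - φ‖ ^ 2 := by
    intro c hc
    refine (h c (hDC hc)).trans ?_
    rw [successProb, EuclideanSpace.norm_sq_eq, Finset.mul_sum, Finset.mul_sum,
      ← Finset.sum_add_distrib]
    refine Finset.sum_le_sum fun s _ => ?_
    split_ifs
    · have h3 : ‖A.state c T s‖ ≤ ‖φ s‖ + ‖(A.state c T - φ) s‖ := by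
        have : A.state c T s = φ s + (A.state c T - φ) s := by simp
        rw [this]
        exact norm_add_le _ _
      nlinarith [sq_nonneg (‖φ s‖ - 6 * ‖(A.state c T - φ) s‖), norm_nonneg (A.state c T s),
        norm_nonneg (φ s), norm_nonneg ((A.state c T - φ) s)]
    · positivity
  have h3 := Finset.sum_le_sum h2
  have h4 : ∑ c ∈ D, ∑ s, (if A.hypothesis s = c then ‖φ s‖ ^ 2 else 0) ≤ 1 := by
    rw [Finset.sum_comm]
    calc ∑ s, ∑ c ∈ D, (if A.hypothesis s = c then ‖φ s‖ ^ 2 else 0)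
        ≤ ∑ s, ‖φ s‖ ^ 2 := by
          refine Finset.sum_le_sum fun s _ => ?_
          rw [Finset.sum_ite_eq]
          split_ifs
          · exact le_rfl
          · positivity
      _ = 1 := by rw [← EuclideanSpace.norm_sq_eq, A.norm_state]; norm_num
  rw [Finset.sum_add_distrib, ← Finset.mul_sum, ← Finset.mul_sum, Finset.sum_const,
    nsmul_eq_mul] at h3
  have h5 : (2 : ℝ) ≤ D.card := by exact_mod_cast hD
  have h6 : (D.card : ℝ) ≤ 336 * (T : ℝ) ^ 2 * minority D x := by nlinarith
  exact_mod_cast h6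

end QuantumAlgorithm

/-! ### A learner that queries every input -/

/-- The permutation `|x, b, w⟩ ↦ |x, w(x), w[x ↦ b]⟩` that exchanges the answer bit with the entry
of the table `w` at `x`. -/
def storePerm (n : ℕ) : Equiv.Perm (Basis n (Concept n)) where
  toFun s := (s.1, s.2.2 s.1, Function.update s.2.2 s.1 s.2.1)
  invFun s := (s.1, s.2.2 s.1, Function.update s.2.2 s.1 s.2.1)
  left_inv s := by simp
  right_inv s := by simp

/-- An algorithm that queries all `2 ^ n` inputs one after the other and records the answers in a
table identifies every concept. -/
theorem exists_exactlyLearns (n : ℕ) (C : Finset (Concept n)) :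
    ∃ T, ∃ A : QuantumAlgorithm n, A.ExactlyLearns T C := by
  classical
  set N := Fintype.card (BitString n)
  let e : BitString n ≃ Fin N := Fintype.equivFin _
  let sq : ℕ → BitString n := fun i => if h : i < N then e.symm ⟨i, h⟩ else fun _ => false
  have hpos : 0 < Fintype.card (Concept n) := Fintype.card_pos
  obtain ⟨d, hd⟩ := Nat.exists_eq_add_of_lt hpos
  let f : Fin (d + 1) ≃ Concept n := (Fintype.equivFinOfCardEq (by omega)).symm
  -- the table is labelled so that the initial basis state stands for the table without entries
  let g : Fin (d + 1) ≃ Concept n := f.trans (Equiv.swap (f 0) fun _ => false)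
  have hg0 : g 0 = fun _ => false := by simp [g]
  let G : Basis n (Fin (d + 1)) ≃ Basis n (Concept n) :=
    Equiv.prodCongr (Equiv.refl _) (Equiv.prodCongr (Equiv.refl _) g)
  let mv : BitString n → BitString n → Equiv.Perm (Basis n (Concept n)) := fun x y =>
    Equiv.prodCongr (Equiv.swap x y) (Equiv.refl _)
  let σ : ℕ → Equiv.Perm (Basis n (Fin (d + 1))) := fun i => match i with
    | 0 => (G.trans (mv (fun _ => false) (sq 0))).trans G.symm
    | i + 1 => ((G.trans (storePerm n)).trans (mv (sq i) (sq (i + 1)))).trans G.symm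
  let A : QuantumAlgorithm n :=
    { workDim := d
      unitary := fun i => LinearIsometryEquiv.piLpCongrLeft 2 ℂ ℂ (σ i)
      hypothesis := fun s => g s.2.2 }
  have hstate : ∀ c : Concept n, ∀ i ≤ N, A.state c i =
      EuclideanSpace.single (G.symm (sq i, false, fun x => c x && decide ((e x : ℕ) < i))) 1 := by
    intro c i
    induction i with
    | zero =>
      intro _
      have h : σ 0 (fun _ => false, false, 0) = G.symm (sq 0, false, fun _ => false) := by
        simp [σ, G, mv, hg0]
      change LinearIsometryEquiv.piLpCongrLeft 2 ℂ ℂ (σ 0) (EuclideanSpace.single _ 1) = _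
      rw [EuclideanSpace.piLpCongrLeft_single, h]
      simp
    | succ i ih =>
      intro hi
      have hx : e (sq i) = ⟨i, hi⟩ := by
        have : i < N := hi
        simp [sq, this]
      rw [QuantumAlgorithm.state, ih (by omega)]
      change LinearIsometryEquiv.piLpCongrLeft 2 ℂ ℂ (σ (i + 1))
        (LinearIsometryEquiv.piLpCongrLeft 2 ℂ ℂ (oraclePerm _ c) (EuclideanSpace.single _ 1)) = _
      rw [EuclideanSpace.piLpCongrLeft_single, EuclideanSpace.piLpCongrLeft_single]
      congr 1
      have htab : Function.update (fun x => c x && decide ((e x : ℕ) < i)) (sq i) (c (sq i)) =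
          fun x => c x && decide ((e x : ℕ) < i + 1) := by
        ext x
        by_cases hxx : x = sq i
        · subst hxx
          simp [hx]
        · have hne : (e x : ℕ) ≠ i := by
            intro h
            exact hxx (e.injective (by rw [hx]; exact Fin.ext h))
          have : (e x : ℕ) < i + 1 ↔ (e x : ℕ) < i := by omega
          simp [Function.update_of_ne hxx, this]
      simp only [σ, G, mv, storePerm, oraclePerm, Equiv.coe_fn_mk, Equiv.trans_apply,
        Equiv.prodCongr_apply, Equiv.prodCongr_symm, Prod.map, Equiv.refl_symm, Equiv.refl_apply,
        Equiv.apply_symm_apply, Equiv.swap_apply_left, Bool.false_xor, htab, hx, lt_self_iff_false,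
        decide_false, Bool.and_false]
  refine ⟨N, A, fun c _ => ?_⟩
  have h : A.successProb N c = 1 := by
    rw [QuantumAlgorithm.successProb, hstate c N le_rfl]
    rw [Finset.sum_eq_single (G.symm (sq N, false, fun x => c x && decide ((e x : ℕ) < N)))]
    · simp [A, G]
    · intro s _ hs
      have : EuclideanSpace.single
          (G.symm (sq N, false, fun x => c x && decide ((e x : ℕ) < N))) (1 : ℂ) s = 0 := by
        simpa using hs
      simp only [this, norm_zero]
      simp
    · simp
  rw [h]
  norm_num

theorem exists_exactlyLearns_quantumQueryComplexity {n : ℕ} (C : Finset (Concept n)) :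
    ∃ A : QuantumAlgorithm n, A.ExactlyLearns (quantumQueryComplexity C) C :=
  Nat.sInf_mem (exists_exactlyLearns n C)

/-! ### Column flips -/

section Flip

variable {n : ℕ}

theorem flipConcept_flipConcept (K : Finset (BitString n)) (c : Concept n) :
    flipConcept K (flipConcept K c) = c := by
  ext x
  simp [flipConcept]

theorem flipConcept_injective (K : Finset (BitString n)) : Function.Injective (flipConcept K) :=
  Function.LeftInverse.injective (flipConcept_flipConcept K)

theorem card_columnFlip (K : Finset (BitString n)) (S : Finset (Concept n)) :
    (columnFlip K S).card = S.card :=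
  Finset.card_image_of_injective _ (flipConcept_injective K)

theorem mem_columnFlip {K : Finset (BitString n)} {S : Finset (Concept n)} {c : Concept n} :
    c ∈ columnFlip K S ↔ flipConcept K c ∈ S := by
  rw [columnFlip, Finset.mem_image]
  refine ⟨?_, fun h => ⟨_, h, flipConcept_flipConcept K c⟩⟩
  rintro ⟨d, hd, rfl⟩
  rwa [flipConcept_flipConcept]

theorem columnFlip_columnFlip (K : Finset (BitString n)) (S : Finset (Concept n)) :
    columnFlip K (columnFlip K S) = S := by
  ext c
  rw [mem_columnFlip, mem_columnFlip, flipConcept_flipConcept]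

theorem columnFlip_mono {K : Finset (BitString n)} {S S' : Finset (Concept n)} (h : S ⊆ S') :
    columnFlip K S ⊆ columnFlip K S' :=
  Finset.image_subset_image h

theorem onesAt_columnFlip (K : Finset (BitString n)) (S : Finset (Concept n)) (x : BitString n) :
    onesAt (columnFlip K S) x = if x ∈ K then zerosAt S x else onesAt S x := by
  rw [onesAt, columnFlip, Finset.filter_image,
    Finset.card_image_of_injective _ (flipConcept_injective K)]
  split_ifs with h <;> simp [flipConcept, h, zerosAt, onesAt]

theorem zerosAt_columnFlip (K : Finset (BitString n)) (S : Finset (Concept n)) (x : BitString n) :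
    zerosAt (columnFlip K S) x = if x ∈ K then onesAt S x else zerosAt S x := by
  rw [zerosAt, columnFlip, Finset.filter_image,
    Finset.card_image_of_injective _ (flipConcept_injective K)]
  split_ifs with h <;> simp [flipConcept, h, zerosAt, onesAt]

theorem minority_columnFlip (K : Finset (BitString n)) (S : Finset (Concept n))
    (x : BitString n) : minority (columnFlip K S) x = minority S x := by
  rw [minority, minority, onesAt_columnFlip, zerosAt_columnFlip]
  split_ifs
  · exact min_comm _ _
  · rfl

theorem onesAt_columnFlip_flipSet (S : Finset (Concept n)) (x : BitString n) :
    onesAt (columnFlip (flipSet S) S) x = minority S x := by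
  rw [onesAt_columnFlip, minority]
  by_cases h : zerosAt S x < onesAt S x
  · simp [flipSet, h, h.le]
  · simp [flipSet, h, not_lt.1 h]

theorem two_mul_minority_le (S : Finset (Concept n)) (x : BitString n) :
    2 * minority S x ≤ S.card := by
  have := onesAt_add_zerosAt S x
  rw [minority]
  omega

end Flip

/-! ### Size of the greedily chosen set of inputs -/

/-- A chosen set `I` of inputs for a class `C`: each input of `I` has value `1` for some concept,
at least half of the concepts (but not all of them) have value `1` somewhere on `I`, and `I` has
at most `G` elements. -/
structure IsSemiRich {n : ℕ} (G : ℕ) (C : Finset (Concept n)) (I : Finset (BitString n)) :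
    Prop where
  card_le : I.card ≤ G
  onesAt_pos : ∀ a ∈ I, 0 < onesAt C a
  two_mul_card_le : 2 * (C.filter fun d => ∀ x ∈ I, d x = false).card ≤ C.card
  nonempty_filter : (C.filter fun d => ∀ x ∈ I, d x = false).Nonempty

theorem bestInput_spec {n : ℕ} (D : Finset (Concept n)) (I : Finset (BitString n))
    (h : Iᶜ.Nonempty) (x : BitString n) (hx : x ∉ I) :
    onesAt D x ≤ onesAt D (bestInput D I h) :=
  (Finset.exists_max_image Iᶜ (onesAt D) h).choose_spec.2 x (Finset.mem_compl.2 hx)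

/-- Every input that the greedy loop adds covers at least the fraction `1 / G` of the concepts that
are not covered yet, which are more than half of all concepts, so that each input covers at least
`|C| / (2 G)` further concepts until half of them are covered. -/
theorem isSemiRich_semiRichLoop {n : ℕ} {G : ℕ} {C : Finset (Concept n)}
    (hG : ∀ D ⊆ C, 2 ≤ D.card → ∃ x, D.card ≤ G * minority D x)
    (hC : ∀ x, 2 * onesAt C x ≤ C.card) (hcard : 2 ≤ C.card) (R : Finset (Concept n))
    (I : Finset (BitString n)) (hR : R = C.filter fun d => ∃ x ∈ I, d x = true)
    (hR2 : 2 * R.card < C.card) (hI : I.card * C.card ≤ 2 * G * R.card)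
    (hones : ∀ a ∈ I, 0 < onesAt C a) :
    IsSemiRich G C (semiRichLoop C R I) := by
  induction hm : Iᶜ.card using Nat.strong_induction_on generalizing R I with
  | _ m ih =>
  subst hm
  have hRC : R ⊆ C := by rw [hR]; exact Finset.filter_subset _ _
  have hD := Finset.card_sdiff_add_card_eq_card hRC
  obtain ⟨x, hx⟩ := hG (C \ R) Finset.sdiff_subset (by omega)
  have hzero : ∀ y ∈ I, onesAt (C \ R) y = 0 := by
    intro y hy
    rw [onesAt, Finset.card_eq_zero, Finset.filter_eq_empty_iff]
    intro d hd hdy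
    rw [Finset.mem_sdiff, hR, Finset.mem_filter] at hd
    exact hd.2 ⟨hd.1, y, hy, hdy⟩
  have hxI : x ∉ I := by
    intro h
    have h1 : minority (C \ R) x = 0 := by
      have := hzero x h
      rw [minority]; omega
    rw [h1] at hx
    omega
  have hne : Iᶜ.Nonempty := ⟨x, Finset.mem_compl.2 hxI⟩
  rw [semiRichLoop, dif_pos hne]
  set a := bestInput (columnFlip (flipSet (C \ R)) (C \ R)) I hne with ha
  have haI : a ∉ I := bestInput_notMem _ _ _
  have hmin : minority (C \ R) x ≤ minority (C \ R) a := by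
    have h := bestInput_spec (columnFlip (flipSet (C \ R)) (C \ R)) I hne x hxI
    rwa [← ha, onesAt_columnFlip_flipSet, onesAt_columnFlip_flipSet] at h
  have hcov : (C \ R).card ≤ G * onesAt (C \ R) a :=
    hx.trans (Nat.mul_le_mul_left _ (hmin.trans (min_le_left _ _)))
  have hR' : R ∪ C.filter (fun c => c a = true) =
      C.filter fun d => ∃ x ∈ insert a I, d x = true := by
    rw [hR]
    ext d
    simp only [Finset.mem_union, Finset.mem_filter, Finset.mem_insert, exists_eq_or_imp]
    rw [← and_or_left, or_comm]
  have hRcard : (R ∪ C.filter fun c => c a = true).card = R.card + onesAt (C \ R) a := by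
    rw [onesAt, ← Finset.card_union_of_disjoint]
    · congr 1
      ext d
      simp only [Finset.mem_union, Finset.mem_filter, Finset.mem_sdiff]
      tauto
    · rw [Finset.disjoint_left]
      intro d hd hd'
      exact (Finset.mem_sdiff.1 (Finset.mem_filter.1 hd').1).2 hd
  have hones' : ∀ b ∈ insert a I, 0 < onesAt C b := by
    intro b hb
    rcases Finset.mem_insert.1 hb with rfl | hb
    · have h1 : 0 < onesAt (C \ R) a := by
        rcases Nat.eq_zero_or_pos (onesAt (C \ R) a) with h | h
        · rw [h] at hcov; omega
        · exact h
      refine h1.trans_le (Finset.card_le_card ?_)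
      exact Finset.filter_subset_filter _ Finset.sdiff_subset
    · exact hones b hb
  have hIcard : (insert a I).card = I.card + 1 := Finset.card_insert_of_notMem haI
  have hI' : (insert a I).card * C.card ≤ 2 * G * (R.card + onesAt (C \ R) a) := by
    rw [hIcard]
    nlinarith
  simp only [← ha]
  split_ifs with h_half
  · have hcompl : (C.filter fun d => ∀ x ∈ insert a I, d x = false) =
        C \ (R ∪ C.filter fun c => c a = true) := by
      rw [hR']
      ext d
      simp only [Finset.mem_filter, Finset.mem_sdiff, not_and, not_exists, Bool.not_eq_true]
      tauto
    have hsub : R ∪ C.filter (fun c => c a = true) ⊆ C :=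
      Finset.union_subset hRC (Finset.filter_subset _ _)
    have hsd := Finset.card_sdiff_add_card_eq_card hsub
    refine ⟨?_, hones', ?_, ?_⟩
    · -- the bound before the last enlargement is strict, as less than half of `C` was covered
      have h1 : I.card * C.card < G * C.card := by
        rcases Nat.eq_zero_or_pos G with h | h
        · subst h; omega
        · nlinarith
      have := lt_of_mul_lt_mul_right h1 (Nat.zero_le _)
      omega
    · rw [hcompl]; omega
    · -- a single column covers at most half of `C`, and more than half of `C` was not covered
      rw [hcompl, ← Finset.card_pos]
      have h1 := Finset.card_union_le R (C.filter fun c => c a = true)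
      have h2 : 2 * (C.filter fun c => c a = true).card ≤ C.card := hC a
      omega
  · refine ih _ ?_ _ _ hR' (by omega) (by rw [hRcard]; exact hI') hones' rfl
    refine Finset.card_lt_card ?_
    rw [Finset.compl_ssubset_compl]
    exact Finset.ssubset_insert haI

theorem isSemiRich_semiRichInputs {n : ℕ} {G : ℕ} {C : Finset (Concept n)}
    (hG : ∀ D ⊆ C, 2 ≤ D.card → ∃ x, D.card ≤ G * minority D x)
    (hC : ∀ x, 2 * onesAt C x ≤ C.card) (hcard : 2 ≤ C.card) :
    IsSemiRich G C (semiRichInputs C) := by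
  refine isSemiRich_semiRichLoop hG hC hcard ∅ ∅ ?_ ?_ ?_ ?_
  · simp
  · rw [Finset.card_empty]; omega
  · simp
  · simp

theorem IsSemiRich.nonempty {n : ℕ} {G : ℕ} {C : Finset (Concept n)} {I : Finset (BitString n)}
    (h : IsSemiRich G C I) : I.Nonempty := by
  rw [Finset.nonempty_iff_ne_empty]
  rintro rfl
  have h1 := h.two_mul_card_le
  have h2 := Finset.card_pos.2 h.nonempty_filter
  simp only [Finset.notMem_empty, false_imp_iff, implies_true, Finset.filter_true] at h1 h2
  omega

/-- The set of inputs that one pass of the learner uses when `S` is the set of candidates. -/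
noncomputable def passInputs {n : ℕ} (S : Finset (Concept n)) : Finset (BitString n) :=
  semiRichInputs (columnFlip (flipSet S) S)

theorem isSemiRich_passInputs {n : ℕ} {G : ℕ} {C S : Finset (Concept n)}
    (hG : ∀ D ⊆ C, 2 ≤ D.card → ∃ x, D.card ≤ G * minority D x) (hS : S ⊆ C)
    (hcard : 2 ≤ S.card) : IsSemiRich G (columnFlip (flipSet S) S) (passInputs S) := by
  refine isSemiRich_semiRichInputs ?_ ?_ ?_
  · intro D hD hD2
    obtain ⟨x, hx⟩ := hG (columnFlip (flipSet S) D)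
      (by
        refine subset_trans (columnFlip_mono hD) ?_
        rwa [columnFlip_columnFlip])
      (by rwa [card_columnFlip])
    exact ⟨x, by rwa [card_columnFlip, minority_columnFlip] at hx⟩
  · intro x
    rw [onesAt_columnFlip_flipSet, card_columnFlip]
    exact two_mul_minority_le S x
  · rwa [card_columnFlip]

/-! ### Expectations of functions with values in `[0, ∞]` -/

section Expect

variable {α β : Type*}

/-- The expectation of `f` under the distribution `p`. -/
noncomputable def expect (p : PMF α) (f : α → ℝ≥0∞) : ℝ≥0∞ := ∑' a, p a * f a

theorem expect_pure (a : α) (f : α → ℝ≥0∞) : expect (PMF.pure a) f = f a := by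
  classical
  rw [expect, tsum_eq_single a]
  · simp [PMF.pure_apply]
  · intro b hb
    simp [PMF.pure_apply, hb]

theorem expect_bind (p : PMF α) (q : α → PMF β) (f : β → ℝ≥0∞) :
    expect (p.bind q) f = expect p fun a => expect (q a) f := by
  simp only [expect, PMF.bind_apply, ← ENNReal.tsum_mul_right, ← ENNReal.tsum_mul_left]
  rw [ENNReal.tsum_comm]
  simp only [mul_assoc]

theorem expect_map (p : PMF α) (g : α → β) (f : β → ℝ≥0∞) :
    expect (p.map g) f = expect p (f ∘ g) := by
  rw [← PMF.bind_pure_comp, expect_bind]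
  simp only [Function.comp_apply, expect_pure]
  rfl

theorem expect_mono {p : PMF α} {f g : α → ℝ≥0∞} (h : ∀ a ∈ p.support, f a ≤ g a) :
    expect p f ≤ expect p g := by
  refine ENNReal.tsum_le_tsum fun a => ?_
  by_cases ha : a ∈ p.support
  · gcongr
    exact h a ha
  · rw [(PMF.apply_eq_zero_iff p a).2 ha]
    simp

theorem expect_const (p : PMF α) (x : ℝ≥0∞) : expect p (fun _ => x) = x := by
  rw [expect, ENNReal.tsum_mul_right, p.tsum_coe, one_mul]

theorem expect_add (p : PMF α) (f g : α → ℝ≥0∞) :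
    expect p (fun a => f a + g a) = expect p f + expect p g := by
  simp only [expect, mul_add]
  exact ENNReal.tsum_add

theorem expect_mul_const (p : PMF α) (f : α → ℝ≥0∞) (x : ℝ≥0∞) :
    expect p (fun a => f a * x) = expect p f * x := by
  simp only [expect, ← mul_assoc]
  exact ENNReal.tsum_mul_right

theorem expect_uniformOfFinset (s : Finset α) (hs : s.Nonempty) (f : α → ℝ≥0∞) :
    expect (PMF.uniformOfFinset s hs) f = (s.card : ℝ≥0∞)⁻¹ * ∑ a ∈ s, f a := by
  rw [expect, tsum_eq_sum (s := s), Finset.mul_sum]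
  · refine Finset.sum_congr rfl fun a ha => ?_
    rw [PMF.uniformOfFinset_apply_of_mem hs ha]
  · intro a ha
    rw [PMF.uniformOfFinset_apply_of_notMem hs ha, zero_mul]

end Expect

/-! ### The states of the Grover search -/

section Grover

variable {n : ℕ}

/-- The vector with amplitude `±a` at the inputs of `I` where `c` has value `1` and `±b` at the
other inputs of `I`, with the sign given by the answer bit. The states of a Grover search on `I`
are of this form. -/
noncomputable def groverVec (c : Concept n) (I : Finset (BitString n)) (a b : ℝ) :
    EuclideanSpace ℂ (Basis n Unit) :=
  WithLp.toLp 2 fun s =>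
    if s.1 ∈ I then (if s.2.1 then -1 else 1) * (if c s.1 then (a : ℂ) else (b : ℂ)) else 0

/-- The targets of a search for an input in `I` with value `1`. -/
def targets (c : Concept n) (I : Finset (BitString n)) : Finset (BitString n) :=
  I.filter fun x => c x = true

/-- The inputs in `I` with value `0`. -/
def nontargets (c : Concept n) (I : Finset (BitString n)) : Finset (BitString n) :=
  I.filter fun x => ¬ c x = true

theorem card_targets_add (c : Concept n) (I : Finset (BitString n)) :
    (targets c I).card + (nontargets c I).card = I.card :=
  Finset.card_filter_add_card_filter_not _

theorem groverStart_eq (c : Concept n) (I : Finset (BitString n)) :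
    groverStart I = groverVec c I (Real.sqrt (2 * (I.card : ℝ)))⁻¹
      (Real.sqrt (2 * (I.card : ℝ)))⁻¹ := by
  ext s
  simp [groverStart, groverVec, div_eq_mul_inv]

theorem oracle_groverVec (c : Concept n) (I : Finset (BitString n)) (a b : ℝ) :
    oracle Unit c (groverVec c I a b) = groverVec c I (-a) b := by
  ext ⟨x, d, w⟩
  rw [oracle_apply]
  simp only [groverVec]
  by_cases hx : x ∈ I <;> cases hc : c x <;> cases d <;> simp [hx]

theorem inner_groverVec (c : Concept n) (I : Finset (BitString n)) (a b a' b' : ℝ) :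
    inner ℂ (groverVec c I a b) (groverVec c I a' b') =
      ((2 * ((targets c I).card * (a * a') + (nontargets c I).card * (b * b')) : ℝ) : ℂ) := by
  rw [PiLp.inner_apply, Fintype.sum_prod_type]
  have h : ∀ x, ∑ p : Bool × Unit, inner ℂ (groverVec c I a b (x, p)) (groverVec c I a' b' (x, p))
      = if x ∈ I then (if c x = true then ((2 * (a * a') : ℝ) : ℂ) else ((2 * (b * b') : ℝ) : ℂ))
        else 0 := by
    intro x
    rw [Fintype.sum_prod_type, Fintype.sum_bool]
    by_cases hx : x ∈ I <;> cases hc : c x <;> simp [groverVec, hx, hc] <;> ring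
  rw [Finset.sum_congr rfl fun x _ => h x, Finset.sum_ite_mem, Finset.univ_inter,
    Finset.sum_ite, Finset.sum_const, Finset.sum_const, targets, nontargets]
  push_cast
  simp only [nsmul_eq_mul]
  ring

theorem norm_sq_groverVec (c : Concept n) (I : Finset (BitString n)) (a b : ℝ) :
    ‖groverVec c I a b‖ ^ 2 =
      2 * ((targets c I).card * a ^ 2 + (nontargets c I).card * b ^ 2) := by
  have h := inner_groverVec c I a b a b
  rw [inner_self_eq_norm_sq_to_K] at h
  have h' : ‖groverVec c I a b‖ ^ 2 =
      2 * ((targets c I).card * (a * a) + (nontargets c I).card * (b * b)) := by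
    refine Complex.ofReal_injective ?_
    push_cast at h ⊢
    exact h
  rw [h']
  ring

theorem norm_groverStart {I : Finset (BitString n)} (hI : I.Nonempty) : ‖groverStart I‖ = 1 := by
  have h := norm_sq_groverVec (fun _ => true) I (Real.sqrt (2 * (I.card : ℝ)))⁻¹
    (Real.sqrt (2 * (I.card : ℝ)))⁻¹
  rw [← groverStart_eq, ← add_mul, ← Nat.cast_add, card_targets_add, inv_pow,
    Real.sq_sqrt (by positivity), ← mul_assoc, mul_inv_cancel₀] at h
  · have h0 := norm_nonneg (groverStart I)
    nlinarith
  · have : (0 : ℝ) < I.card := by exact_mod_cast hI.card_pos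
    positivity

theorem groverIteration_groverVec (c : Concept n) {I : Finset (BitString n)} (hI : I.Nonempty)
    (a b : ℝ) :
    groverIteration c I (groverVec c I a b) =
      groverVec c I
        (2 * ((nontargets c I).card * b - (targets c I).card * a) / I.card + a)
        (2 * ((nontargets c I).card * b - (targets c I).card * a) / I.card - b) := by
  have hN : (0 : ℝ) < I.card := by exact_mod_cast hI.card_pos
  set r := (Real.sqrt (2 * (I.card : ℝ)))⁻¹ with hr
  have hr2 : r * r = 1 / (2 * (I.card : ℝ)) := by
    rw [hr, ← mul_inv, Real.mul_self_sqrt (by positivity), one_div]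
  rw [groverIteration, Submodule.reflection_apply,
    Submodule.starProjection_unit_singleton ℂ (norm_groverStart hI), oracle_groverVec,
    groverStart_eq c I, ← hr, inner_groverVec]
  set p := 2 * (((targets c I).card : ℝ) * (r * -a) + (nontargets c I).card * (r * b)) with hp
  have hpr : 2 * ((nontargets c I).card * b - (targets c I).card * a) / I.card = 2 * (p * r) := by
    have : p * r = 2 * ((nontargets c I).card * b - (targets c I).card * a) * (r * r) := by
      rw [hp]; ring
    rw [this, hr2]
    field_simp
  rw [hpr]
  ext s
  simp only [groverVec, PiLp.sub_apply, PiLp.smul_apply, smul_eq_mul, two_smul, PiLp.add_apply]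
  split_ifs <;> push_cast <;> ring

theorem iterate_groverIteration_eq_groverVec (c : Concept n) {I : Finset (BitString n)}
    (hI : I.Nonempty) (j : ℕ) :
    ∃ a b, (groverIteration c I)^[j] (groverStart I) = groverVec c I a b := by
  induction j with
  | zero => exact ⟨_, _, groverStart_eq c I⟩
  | succ j ih =>
    obtain ⟨a, b, h⟩ := ih
    rw [Function.iterate_succ_apply', h, groverIteration_groverVec c hI]
    exact ⟨_, _, rfl⟩

theorem norm_iterate_groverIteration (c : Concept n) {I : Finset (BitString n)}
    (hI : I.Nonempty) (j : ℕ) : ‖(groverIteration c I)^[j] (groverStart I)‖ = 1 := by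
  induction j with
  | zero => exact norm_groverStart hI
  | succ j ih =>
    rw [Function.iterate_succ_apply', groverIteration, LinearIsometryEquiv.norm_map,
      LinearIsometryEquiv.norm_map, ih]

/-- The amplitudes after `j` Grover iterations: each iteration is a rotation by the angle `2 θ`,
where `sin² θ` is the fraction of targets. -/
theorem iterate_groverIteration_eq (c : Concept n) {I : Finset (BitString n)} (hI : I.Nonempty)
    (θ : ℝ) (hs : Real.sin θ ≠ 0) (hc : Real.cos θ ≠ 0)
    (ht : ((targets c I).card : ℝ) = I.card * Real.sin θ ^ 2)
    (hu : ((nontargets c I).card : ℝ) = I.card * Real.cos θ ^ 2) (j : ℕ) :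
    (groverIteration c I)^[j] (groverStart I) =
      groverVec c I ((Real.sqrt (2 * (I.card : ℝ)))⁻¹ * (Real.sin ((2 * j + 1) * θ) / Real.sin θ))
        ((Real.sqrt (2 * (I.card : ℝ)))⁻¹ * (Real.cos ((2 * j + 1) * θ) / Real.cos θ)) := by
  have hN : (I.card : ℝ) ≠ 0 := by
    have : (0 : ℝ) < I.card := by exact_mod_cast hI.card_pos
    exact this.ne'
  induction j with
  | zero =>
    simp only [Function.iterate_zero, id_eq, Nat.cast_zero, mul_zero, zero_add, one_mul,
      div_self hs, div_self hc, mul_one]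
    exact groverStart_eq c I
  | succ j ih =>
    rw [Function.iterate_succ_apply', ih, groverIteration_groverVec c hI, ht, hu]
    set r := (Real.sqrt (2 * (I.card : ℝ)))⁻¹
    have harg : (2 * ((j + 1 : ℕ) : ℝ) + 1) * θ = (2 * j + 1) * θ + 2 * θ := by
      push_cast; ring
    rw [harg]
    set φ := (2 * (j : ℝ) + 1) * θ
    congr 1
    · rw [Real.sin_add, Real.sin_two_mul, Real.cos_two_mul']
      field_simp
      linear_combination (-Real.sin φ * r) * Real.sin_sq_add_cos_sq θ
    · rw [Real.cos_add, Real.sin_two_mul, Real.cos_two_mul]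
      field_simp
      ring

end Grover

/-! ### One round of the Grover search -/

section Round

variable {n : ℕ}

/-- The indicator of the event that the input `x` is no target. -/
noncomputable def miss (c : Concept n) (x : BitString n) : ℝ≥0∞ := if c x = true then 0 else 1

theorem expect_groverSample_miss (c : Concept n) {I : Finset (BitString n)} (hI : I.Nonempty)
    (j : ℕ) {a b : ℝ} (h : (groverIteration c I)^[j] (groverStart I) = groverVec c I a b) :
    expect (groverSample c I j) (miss c) =
      ENNReal.ofReal (2 * ((nontargets c I).card * b ^ 2)) := by
  have hnorm := norm_iterate_groverIteration c hI j
  rw [h] at hnorm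
  have hsum : ∑ s : Basis n Unit, (if c s.1 = true then 0 else ‖groverVec c I a b s‖ ^ 2) =
      2 * ((nontargets c I).card * b ^ 2) := by
    have h0 := norm_sq_groverVec c I 0 b
    rw [EuclideanSpace.norm_sq_eq] at h0
    rw [show 2 * ((nontargets c I).card * b ^ 2) =
      2 * ((targets c I).card * (0 : ℝ) ^ 2 + (nontargets c I).card * b ^ 2) by ring, ← h0]
    refine Finset.sum_congr rfl fun s _ => ?_
    by_cases hs : c s.1 = true <;> simp [groverVec, hs]
  rw [groverSample, expect_map, h, measure, dif_pos hnorm, expect, tsum_fintype, ← hsum,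
    ENNReal.ofReal_sum_of_nonneg]
  · refine Finset.sum_congr rfl fun s _ => ?_
    rw [PMF.ofFintype_apply]
    by_cases hs : c s.1 = true <;> simp [miss, hs]
  · intro s _
    split_ifs <;> positivity

theorem mem_of_mem_support_groverSample {c : Concept n} {I : Finset (BitString n)}
    (hI : I.Nonempty) {j : ℕ} {x : BitString n} (hx : x ∈ (groverSample c I j).support) :
    x ∈ I := by
  obtain ⟨a, b, h⟩ := iterate_groverIteration_eq_groverVec c hI j
  have hnorm := norm_iterate_groverIteration c hI j
  rw [groverSample, PMF.mem_support_map_iff] at hx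
  obtain ⟨s, hs, rfl⟩ := hx
  rw [h] at hs hnorm
  rw [measure, dif_pos hnorm, PMF.mem_support_iff, PMF.ofFintype_apply] at hs
  by_contra hsI
  simp [groverVec, hsI] at hs

theorem four_mul_sin_mul_sum_cos_sq (θ : ℝ) (m : ℕ) :
    4 * Real.sin (2 * θ) * ∑ j ∈ Finset.range m, Real.cos ((2 * j + 1) * θ) ^ 2 =
      2 * m * Real.sin (2 * θ) + Real.sin (4 * m * θ) := by
  induction m with
  | zero => simp
  | succ m ih =>
    rw [Finset.sum_range_succ, mul_add, ih]
    set φ := (2 * (m : ℝ) + 1) * θ with hφ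
    have h1 : 4 * (m : ℝ) * θ = 2 * φ - 2 * θ := by rw [hφ]; ring
    have h2 : 4 * ((m + 1 : ℕ) : ℝ) * θ = 2 * φ + 2 * θ := by rw [hφ]; push_cast; ring
    rw [h1, h2, Real.sin_sub, Real.sin_add, Real.cos_two_mul φ]
    push_cast
    ring

theorem ceilSqrtCard_pos {I : Finset (BitString n)} (hI : I.Nonempty) : 0 < ceilSqrtCard I := by
  rw [ceilSqrtCard, Nat.ceil_pos, Real.sqrt_pos]
  exact_mod_cast hI.card_pos

theorem card_le_ceilSqrtCard_sq (I : Finset (BitString n)) :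
    (I.card : ℝ) ≤ (ceilSqrtCard I : ℝ) ^ 2 := by
  have h := Nat.le_ceil (Real.sqrt (I.card : ℝ))
  calc (I.card : ℝ) = Real.sqrt I.card ^ 2 := (Real.sq_sqrt (Nat.cast_nonneg _)).symm
    _ ≤ _ := by
      gcongr
      exact h

/-- A round with a random number of fewer than `⌈√|I|⌉` iterations misses the targets with
probability at most `3/4`. If not all inputs are targets, then `sin (2 θ) ≥ 1 / ⌈√|I|⌉`, so that
the oscillating part of the sum of the probabilities `cos² ((2 j + 1) θ)` is small. -/
theorem sum_expect_groverSample_miss_le (c : Concept n) {I : Finset (BitString n)}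
    (hI : (targets c I).Nonempty) :
    ∑ j ∈ Finset.range (ceilSqrtCard I), expect (groverSample c I j) (miss c) ≤
      ENNReal.ofReal (3 / 4 * ceilSqrtCard I) := by
  have hI' : I.Nonempty := hI.mono (Finset.filter_subset _ _)
  rcases Finset.eq_empty_or_nonempty (nontargets c I) with hu | hu
  · rw [Finset.sum_eq_zero]
    · exact zero_le
    · intro j _
      obtain ⟨a, b, h⟩ := iterate_groverIteration_eq_groverVec c hI' j
      rw [expect_groverSample_miss c hI' j h, hu]
      simp
  have htN := hI.card_pos
  have huN := hu.card_pos
  have hNN := card_targets_add c I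
  have hN : (0 : ℝ) < I.card := by exact_mod_cast hI'.card_pos
  have ht : (1 : ℝ) ≤ (targets c I).card := by exact_mod_cast htN
  have hu1 : (1 : ℝ) ≤ (nontargets c I).card := by exact_mod_cast huN
  have hsum : ((targets c I).card : ℝ) + (nontargets c I).card = I.card := by exact_mod_cast hNN
  set t := ((targets c I).card : ℝ)
  set u := ((nontargets c I).card : ℝ)
  set N := (I.card : ℝ)
  have hdiv : t / N ≤ 1 := by rw [div_le_one hN]; linarith
  set θ := Real.arcsin (Real.sqrt (t / N)) with hθ
  have hsin : Real.sin θ = Real.sqrt (t / N) := by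
    refine Real.sin_arcsin ?_ ?_
    · linarith [Real.sqrt_nonneg (t / N)]
    · rwa [Real.sqrt_le_one]
  have hsin2 : Real.sin θ ^ 2 = t / N := by rw [hsin, Real.sq_sqrt (by positivity)]
  have hcos2 : Real.cos θ ^ 2 = u / N := by
    rw [Real.cos_sq', hsin2]
    field_simp
    linarith
  have hs0 : 0 < Real.sin θ := by rw [hsin]; positivity
  have hc0 : 0 < Real.cos θ := by
    have h1 : 0 ≤ Real.cos θ := Real.cos_arcsin_nonneg _
    refine lt_of_le_of_ne h1 fun h => ?_
    rw [← h] at hcos2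
    have : 0 < u / N := by positivity
    linarith
  have hmiss : ∀ j, expect (groverSample c I j) (miss c) =
      ENNReal.ofReal (Real.cos ((2 * j + 1) * θ) ^ 2) := by
    intro j
    rw [expect_groverSample_miss c hI' j (iterate_groverIteration_eq c hI' θ hs0.ne' hc0.ne'
      (by rw [hsin2]; exact (mul_div_cancel₀ t hN.ne').symm)
      (by rw [hcos2]; exact (mul_div_cancel₀ u hN.ne').symm) j)]
    congr 1
    change 2 * (u * ((Real.sqrt (2 * N))⁻¹ * _) ^ 2) = _
    rw [mul_pow, inv_pow, Real.sq_sqrt (by positivity), div_pow, hcos2]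
    field_simp
  simp_rw [hmiss]
  rw [← ENNReal.ofReal_sum_of_nonneg fun _ _ => sq_nonneg _]
  refine ENNReal.ofReal_le_ofReal ?_
  have hm := card_le_ceilSqrtCard_sq I
  have hm0 : (0 : ℝ) < ceilSqrtCard I := by exact_mod_cast ceilSqrtCard_pos hI'
  have hkey := four_mul_sin_mul_sum_cos_sq θ (ceilSqrtCard I)
  set m := (ceilSqrtCard I : ℝ)
  have hs2 : 0 < Real.sin (2 * θ) := by rw [Real.sin_two_mul]; positivity
  have hms : 1 ≤ m * Real.sin (2 * θ) := by
    have h1 : (m * Real.sin (2 * θ)) ^ 2 = m ^ 2 * (4 * (t * u)) / N ^ 2 := by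
      rw [Real.sin_two_mul, mul_pow, mul_pow, mul_pow, hsin2, hcos2]
      field_simp
      ring
    have h2 : 1 ≤ (m * Real.sin (2 * θ)) ^ 2 := by
      rw [h1, le_div_iff₀ (by positivity)]
      have h3 : N ≤ 4 * (t * u) := by nlinarith
      calc 1 * N ^ 2 = N * N := by ring
        _ ≤ m ^ 2 * (4 * (t * u)) := by gcongr
    have h3 : 0 < m * Real.sin (2 * θ) := by positivity
    nlinarith
  have h4 := Real.sin_le_one (4 * m * θ)
  have h5 : 4 * Real.sin (2 * θ) * ∑ j ∈ Finset.range (ceilSqrtCard I),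
      Real.cos ((2 * j + 1) * θ) ^ 2 ≤ 4 * Real.sin (2 * θ) * (3 / 4 * m) := by
    rw [hkey]
    linarith
  exact le_of_mul_le_mul_left h5 (by positivity)

end Round

/-! ### The Grover search and its repetitions -/

section Search

variable {n : ℕ}

theorem max_one_ceilSqrtCard {I : Finset (BitString n)} (hI : I.Nonempty) :
    max 1 (ceilSqrtCard I) = ceilSqrtCard I :=
  max_eq_right (ceilSqrtCard_pos hI)

theorem groverLoop_eq (c : Concept n) {I : Finset (BitString n)} (hI : I.Nonempty) (b : ℕ)
    (last : BitString n) :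
    groverLoop c I b last =
      (PMF.uniformOfFinset (Finset.range (ceilSqrtCard I))
        (Finset.nonempty_range_iff.2 (ceilSqrtCard_pos hI).ne')).bind fun j =>
        if j + 1 ≤ b then
          (groverSample c I j).bind fun a =>
            if c a = true then PMF.pure (a, j + 1)
            else (groverLoop c I (b - (j + 1)) a).map fun r => (r.1, r.2 + (j + 1))
        else PMF.pure (last, 0) := by
  rw [groverLoop]
  congr 2
  exact congrArg _ (max_one_ceilSqrtCard hI)

theorem snd_le_of_mem_support_groverLoop (c : Concept n) (I : Finset (BitString n)) (b : ℕ)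
    (last : BitString n) (r : BitString n × ℕ) (hr : r ∈ (groverLoop c I b last).support) :
    r.2 ≤ b := by
  induction b using Nat.strong_induction_on generalizing last r with
  | _ b ih =>
  rw [groverLoop, PMF.mem_support_bind_iff] at hr
  obtain ⟨j, -, hr⟩ := hr
  split_ifs at hr with hj
  · rw [PMF.mem_support_bind_iff] at hr
    obtain ⟨a, -, hr⟩ := hr
    split_ifs at hr with ha
    · rw [PMF.mem_support_pure_iff] at hr
      subst hr
      exact hj
    · rw [PMF.mem_support_map_iff] at hr
      obtain ⟨r', hr', rfl⟩ := hr
      have := ih _ (by omega) _ _ hr'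
      simp only
      omega
  · rw [PMF.mem_support_pure_iff] at hr
    subst hr
    exact Nat.zero_le _

theorem fst_mem_of_mem_support_groverLoop {c : Concept n} {I : Finset (BitString n)}
    (hI : I.Nonempty) (b : ℕ) (last : BitString n) (h : last ∈ I ∨ ceilSqrtCard I ≤ b)
    (r : BitString n × ℕ) (hr : r ∈ (groverLoop c I b last).support) : r.1 ∈ I := by
  induction b using Nat.strong_induction_on generalizing last r with
  | _ b ih =>
  rw [groverLoop_eq c hI, PMF.mem_support_bind_iff] at hr
  obtain ⟨j, hjm, hr⟩ := hr
  rw [PMF.support_uniformOfFinset, Finset.coe_range, Set.mem_Iio] at hjm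
  split_ifs at hr with hj
  · rw [PMF.mem_support_bind_iff] at hr
    obtain ⟨a, haI, hr⟩ := hr
    have haI := mem_of_mem_support_groverSample hI haI
    split_ifs at hr with ha
    · rw [PMF.mem_support_pure_iff] at hr
      subst hr
      exact haI
    · rw [PMF.mem_support_map_iff] at hr
      obtain ⟨r', hr', rfl⟩ := hr
      exact ih (b - (j + 1)) (by omega) a (Or.inl haI) r' hr'
  · rw [PMF.mem_support_pure_iff] at hr
    subst hr
    rcases h with h | h
    · exact h
    · omega

/-- A budget of `k ⌈√|I|⌉` queries suffices for `k` rounds, each of which fails with probability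
at most `3/4`. -/
theorem expect_groverLoop_miss_le (c : Concept n) {I : Finset (BitString n)}
    (hI : (targets c I).Nonempty) (k b : ℕ) (hb : k * ceilSqrtCard I ≤ b) (last : BitString n) :
    expect (groverLoop c I b last) (fun r => miss c r.1) ≤ (3 / 4) ^ k := by
  have hI' : I.Nonempty := hI.mono (Finset.filter_subset _ _)
  induction k generalizing b last with
  | zero =>
    rw [pow_zero, ← expect_const (groverLoop c I b last) 1]
    refine expect_mono fun r _ => ?_
    rw [miss]
    split_ifs <;> simp
  | succ k ih =>
    have hm := ceilSqrtCard_pos hI'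
    rw [groverLoop_eq c hI', expect_bind, expect_uniformOfFinset, Finset.card_range]
    have hstep : ∀ j ∈ Finset.range (ceilSqrtCard I),
        expect (if j + 1 ≤ b then
          (groverSample c I j).bind fun a =>
            if c a = true then PMF.pure (a, j + 1)
            else (groverLoop c I (b - (j + 1)) a).map fun r => (r.1, r.2 + (j + 1))
          else PMF.pure (last, 0)) (fun r => miss c r.1) ≤
        expect (groverSample c I j) (miss c) * (3 / 4) ^ k := by
      intro j hj
      rw [Finset.mem_range] at hj
      rw [Nat.succ_mul] at hb
      rw [if_pos (by omega), expect_bind, ← expect_mul_const]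
      refine expect_mono fun a _ => ?_
      by_cases ha : c a = true
      · rw [if_pos ha, expect_pure]
        simp [miss, ha]
      · rw [if_neg ha, expect_map, miss, if_neg ha, one_mul]
        exact ih _ (by omega) _
    refine (mul_le_mul_right (Finset.sum_le_sum hstep) _).trans ?_
    rw [← Finset.sum_mul, ← mul_assoc, pow_succ']
    refine mul_le_mul_left ?_ _
    refine (mul_le_mul_right (sum_expect_groverSample_miss_le c hI) _).trans (le_of_eq ?_)
    rw [ENNReal.ofReal_mul (by norm_num), ENNReal.ofReal_natCast, mul_comm, mul_assoc,
      ENNReal.mul_inv_cancel (by exact_mod_cast hm.ne') (ENNReal.natCast_ne_top _), mul_one,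
      ENNReal.ofReal_div_of_pos (by norm_num)]
    norm_num

theorem expect_subsetGrover_miss_le (c : Concept n) {I : Finset (BitString n)}
    (hI : (targets c I).Nonempty) :
    expect (subsetGrover c I) (fun r => miss c r.1) ≤ 2⁻¹ := by
  refine (expect_groverLoop_miss_le c hI 4 _ (by omega) _).trans ?_
  have h : (3 / 4 : ℝ≥0∞) = ENNReal.ofReal (3 / 4) := by
    rw [ENNReal.ofReal_div_of_pos (by norm_num)]
    norm_num
  rw [h, ← ENNReal.ofReal_pow (by norm_num), ← ENNReal.ofReal_ofNat 2,
    ← ENNReal.ofReal_inv_of_pos (by norm_num)]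
  exact ENNReal.ofReal_le_ofReal (by norm_num)

/-- An upper bound for the number of queries of one repetition of the inner loop: the budget of the
Grover search and one classical query. -/
noncomputable def searchCost (I : Finset (BitString n)) : ℕ := 9 * ceilSqrtCard I / 2 + 1

theorem mem_support_innerLoop {c : Concept n} {I : Finset (BitString n)} (hI : I.Nonempty)
    (k : ℕ) (r : Option (BitString n) × ℕ) (hr : r ∈ (innerLoop c I k).support) :
    (∀ a, r.1 = some a → a ∈ I ∧ c a = true) ∧ r.2 ≤ k * searchCost I := by
  induction k generalizing r with
  | zero =>
    rw [innerLoop, PMF.mem_support_pure_iff] at hr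
    subst hr
    simp
  | succ k ih =>
    rw [innerLoop, PMF.mem_support_bind_iff] at hr
    obtain ⟨p, hp, hr⟩ := hr
    have hm := ceilSqrtCard_pos hI
    have h1 := fst_mem_of_mem_support_groverLoop hI _ _ (Or.inr (by omega)) p hp
    have h2 := snd_le_of_mem_support_groverLoop c I _ _ p hp
    rw [Nat.succ_mul]
    have h3 : p.2 + 1 ≤ searchCost I := Nat.succ_le_succ h2
    split_ifs at hr with hc
    · rw [PMF.mem_support_pure_iff] at hr
      subst hr
      refine ⟨?_, ?_⟩
      · rintro a ha
        obtain rfl := Option.some.inj ha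
        exact ⟨h1, hc⟩
      · simp only
        omega
    · rw [PMF.mem_support_map_iff] at hr
      obtain ⟨s, hs, rfl⟩ := hr
      obtain ⟨h4, h5⟩ := ih s hs
      refine ⟨h4, ?_⟩
      simp only
      omega

theorem expect_innerLoop_none_le (c : Concept n) {I : Finset (BitString n)}
    (hI : (targets c I).Nonempty) (k : ℕ) :
    expect (innerLoop c I k) (fun r => if r.1 = none then 1 else 0) ≤ 2⁻¹ ^ k := by
  induction k with
  | zero => simp [innerLoop, expect_pure]
  | succ k ih =>
    rw [innerLoop, expect_bind, pow_succ']
    refine le_trans ?_ (mul_le_mul_left (expect_subsetGrover_miss_le c hI) _)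
    rw [← expect_mul_const]
    refine expect_mono fun p _ => ?_
    by_cases hp : c p.1 = true
    · rw [if_pos hp, expect_pure]
      simp
    · rw [if_neg hp, expect_map, miss, if_neg hp, one_mul]
      exact ih

end Search

/-! ### One pass of the learner -/

section Pass

variable {n : ℕ}

/-- The candidates that remain of `S` after a pass whose inner loop has the result `o`. -/
noncomputable def nextCandidates (S : Finset (Concept n)) (o : Option (BitString n)) :
    Finset (Concept n) :=
  match o with
  | some a =>
    columnFlip (flipSet S) ((columnFlip (flipSet S) S).filter fun d => d a = true)
  | none =>
    columnFlip (flipSet S)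
      ((columnFlip (flipSet S) S).filter fun d => ∀ x ∈ passInputs S, d x = false)

theorem outerStep_eq (C : Finset (Concept n)) (c : Concept n) {S : Finset (Concept n)} (q : ℕ)
    (hS : S.card ≠ 1) :
    outerStep C c (S, q) = (innerLoop (flipConcept (flipSet S) c) (passInputs S)
      (innerRounds C)).map fun r => (nextCandidates S r.1, q + r.2) := by
  rw [outerStep, if_neg hS]
  simp only [passInputs]
  congr 1

theorem nextCandidates_subset (S : Finset (Concept n)) (o : Option (BitString n)) :
    nextCandidates S o ⊆ S := by
  have h : ∀ p : Concept n → Prop, ∀ [DecidablePred p],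
      columnFlip (flipSet S) ((columnFlip (flipSet S) S).filter p) ⊆ S := by
    intro p _
    refine subset_trans (columnFlip_mono (Finset.filter_subset _ _)) ?_
    rw [columnFlip_columnFlip]
  cases o <;> exact h _

theorem nextCandidates_nonempty {G : ℕ} {S : Finset (Concept n)}
    (h : IsSemiRich G (columnFlip (flipSet S) S) (passInputs S)) {o : Option (BitString n)}
    (ho : ∀ a, o = some a → a ∈ passInputs S) : (nextCandidates S o).Nonempty := by
  rw [← Finset.card_pos]
  cases o with
  | some a =>
    rw [nextCandidates, card_columnFlip]
    exact h.onesAt_pos a (ho a rfl)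
  | none =>
    rw [nextCandidates, card_columnFlip]
    exact h.nonempty_filter.card_pos

theorem two_mul_card_nextCandidates_le {G : ℕ} {S : Finset (Concept n)}
    (h : IsSemiRich G (columnFlip (flipSet S) S) (passInputs S)) (o : Option (BitString n)) :
    2 * (nextCandidates S o).card ≤ S.card := by
  cases o with
  | some a =>
    have h1 := onesAt_columnFlip_flipSet S a
    rw [onesAt] at h1
    rw [nextCandidates, card_columnFlip, h1]
    exact two_mul_minority_le S a
  | none =>
    have h1 := h.two_mul_card_le
    rw [card_columnFlip] at h1
    rwa [nextCandidates, card_columnFlip]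

theorem mem_nextCandidates_some {S : Finset (Concept n)} {c : Concept n} (hc : c ∈ S)
    {a : BitString n} (ha : flipConcept (flipSet S) c a = true) :
    c ∈ nextCandidates S (some a) := by
  rw [nextCandidates, mem_columnFlip, Finset.mem_filter, mem_columnFlip,
    flipConcept_flipConcept]
  exact ⟨hc, ha⟩

theorem mem_nextCandidates_none {S : Finset (Concept n)} {c : Concept n} (hc : c ∈ S)
    (h : ¬ (targets (flipConcept (flipSet S) c) (passInputs S)).Nonempty) :
    c ∈ nextCandidates S none := by
  rw [nextCandidates, mem_columnFlip, Finset.mem_filter, mem_columnFlip,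
    flipConcept_flipConcept]
  refine ⟨hc, fun x hx => ?_⟩
  by_contra hne
  exact h ⟨x, Finset.mem_filter.2 ⟨hx, by simpa using hne⟩⟩

/-- The potential that bounds the probability that the final candidate is wrong: it is `1` once the
target `c` has been lost, and otherwise `δ` for each further halving of the candidates. -/
noncomputable def failurePotential (c : Concept n) (δ : ℝ≥0∞) (S : Finset (Concept n)) : ℝ≥0∞ :=
  if c ∈ S then δ * Nat.log 2 S.card else 1

/-- In expectation the potential does not increase in a pass: a pass loses the target with
probability at most `2⁻¹ ^ innerRounds C`, and it halves the set of candidates. -/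
theorem expect_outerStep_failurePotential_le {G : ℕ} {C : Finset (Concept n)}
    (hG : ∀ D ⊆ C, 2 ≤ D.card → ∃ x, D.card ≤ G * minority D x) (c : Concept n)
    (st : Finset (Concept n) × ℕ) (hS : st.1 ⊆ C) (hne : st.1.Nonempty) :
    expect (outerStep C c st)
      (fun st' => failurePotential c (2⁻¹ ^ innerRounds C) st'.1) ≤
        failurePotential c (2⁻¹ ^ innerRounds C) st.1 := by
  obtain ⟨S, q⟩ := st
  dsimp only at hS hne ⊢
  by_cases h1 : S.card = 1
  · rw [outerStep, if_pos h1, expect_pure]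
  have hcard : 2 ≤ S.card := by
    have := hne.card_pos
    omega
  rw [outerStep_eq C c q h1, expect_map]
  have hrich := isSemiRich_passInputs hG hS hcard
  set δ : ℝ≥0∞ := 2⁻¹ ^ innerRounds C
  set p := innerLoop (flipConcept (flipSet S) c) (passInputs S) (innerRounds C)
  by_cases hc : c ∈ S
  swap
  · rw [failurePotential, if_neg hc, ← expect_const p 1]
    refine expect_mono fun r _ => ?_
    rw [Function.comp_apply, failurePotential,
      if_neg fun h => hc (nextCandidates_subset S r.1 h)]
  have hlog : 1 ≤ Nat.log 2 S.card := Nat.log_pos (by norm_num) hcard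
  have hkeep : ∀ r ∈ p.support, c ∈ nextCandidates S r.1 →
      failurePotential c δ (nextCandidates S r.1) ≤ δ * (Nat.log 2 S.card - 1 : ℕ) := by
    intro r hr hcr
    rw [failurePotential, if_pos hcr]
    gcongr
    have h2 := two_mul_card_nextCandidates_le hrich r.1
    have h3 : (nextCandidates S r.1).card ≤ S.card / 2 := by omega
    calc Nat.log 2 (nextCandidates S r.1).card ≤ Nat.log 2 (S.card / 2) := Nat.log_mono_right h3
      _ = _ := Nat.log_div_base _ _
  have hsome : ∀ r ∈ p.support, ∀ a, r.1 = some a → c ∈ nextCandidates S r.1 := by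
    intro r hr a ha
    rw [ha]
    exact mem_nextCandidates_some hc
      (((mem_support_innerLoop hrich.nonempty _ r hr).1 a ha).2)
  rw [failurePotential, if_pos hc]
  by_cases ht : (targets (flipConcept (flipSet S) c) (passInputs S)).Nonempty
  · calc expect p _ ≤ expect p fun r =>
          δ * (Nat.log 2 S.card - 1 : ℕ) + if r.1 = none then 1 else 0 := by
          refine expect_mono fun r hr => ?_
          rw [Function.comp_apply]
          by_cases hcr : c ∈ nextCandidates S r.1
          · exact (hkeep r hr hcr).trans le_self_add
          · rw [failurePotential, if_neg hcr]
            have hnone : r.1 = none := by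
              rw [Option.eq_none_iff_forall_ne_some]
              exact fun a ha => hcr (hsome r hr a ha)
            rw [if_pos hnone]
            exact le_add_self
      _ ≤ δ * (Nat.log 2 S.card - 1 : ℕ) + δ := by
          rw [expect_add, expect_const]
          gcongr
          exact expect_innerLoop_none_le _ ht _
      _ = δ * Nat.log 2 S.card := by
          rw [← mul_add_one]
          congr 1
          exact_mod_cast Nat.sub_add_cancel hlog
  · rw [← expect_const p (δ * (Nat.log 2 S.card : ℝ≥0∞))]
    refine expect_mono fun r hr => ?_
    have hcr : c ∈ nextCandidates S r.1 := by
      rcases hr1 : r.1 with _ | a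
      · exact mem_nextCandidates_none hc ht
      · rw [← hr1]
        exact hsome r hr a hr1
    refine (hkeep r hr hcr).trans ?_
    gcongr
    exact Nat.sub_le _ _

end Pass

/-! ### All passes of the learner -/

section Learner

variable {n : ℕ}

/-- Invariant of the outer loop: `p` counts the passes that started with more than one candidate;
each of them halves the set of candidates and makes at most `innerRounds C * B` queries. -/
theorem mem_support_outerLoop {G B : ℕ} {C : Finset (Concept n)}
    (hG : ∀ D ⊆ C, 2 ≤ D.card → ∃ x, D.card ≤ G * minority D x) (hC : C.Nonempty)
    (hB : ∀ I : Finset (BitString n), I.card ≤ G → searchCost I ≤ B) (c : Concept n) (k : ℕ)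
    (st : Finset (Concept n) × ℕ) (hst : st ∈ (outerLoop C c k).support) :
    st.1 ⊆ C ∧ st.1.Nonempty ∧ ∃ p, 2 ^ p * st.1.card ≤ C.card ∧
      st.2 ≤ p * (innerRounds C * B) ∧ (st.1.card = 1 ∨ p = k) := by
  induction k generalizing st with
  | zero =>
    rw [outerLoop, PMF.mem_support_pure_iff] at hst
    subst hst
    exact ⟨subset_rfl, hC, 0, by simp, by simp, Or.inr rfl⟩
  | succ k ih =>
    rw [outerLoop, PMF.mem_support_bind_iff] at hst
    obtain ⟨⟨S, q⟩, hS, hst⟩ := hst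
    obtain ⟨hSC, hne, p, hp, hq, hpk⟩ := ih _ hS
    dsimp only at hSC hne hp hq hpk
    by_cases h1 : S.card = 1
    · rw [outerStep, if_pos h1, PMF.mem_support_pure_iff] at hst
      subst hst
      exact ⟨hSC, hne, p, hp, hq, Or.inl h1⟩
    have hcard : 2 ≤ S.card := by
      have := hne.card_pos
      omega
    have hrich := isSemiRich_passInputs hG hSC hcard
    rw [outerStep_eq C c q h1, PMF.mem_support_map_iff] at hst
    obtain ⟨r, hr, rfl⟩ := hst
    obtain ⟨hr1, hr2⟩ := mem_support_innerLoop hrich.nonempty _ r hr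
    refine ⟨(nextCandidates_subset S r.1).trans hSC,
      nextCandidates_nonempty hrich fun a ha => (hr1 a ha).1, p + 1, ?_, ?_, ?_⟩
    · have h2 := two_mul_card_nextCandidates_le hrich r.1
      calc 2 ^ (p + 1) * (nextCandidates S r.1).card
          = 2 ^ p * (2 * (nextCandidates S r.1).card) := by ring
        _ ≤ 2 ^ p * S.card := Nat.mul_le_mul_left _ h2
        _ ≤ C.card := hp
    · have h3 := Nat.mul_le_mul_left (innerRounds C) (hB _ hrich.card_le)
      dsimp only
      rw [Nat.succ_mul]
      omega
    · rcases hpk with h | h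
      · exact absurd h h1
      · exact Or.inr (by rw [h])

theorem mem_support_learner {G B : ℕ} {C : Finset (Concept n)}
    (hG : ∀ D ⊆ C, 2 ≤ D.card → ∃ x, D.card ≤ G * minority D x) (hC : C.Nonempty)
    (hB : ∀ I : Finset (BitString n), I.card ≤ G → searchCost I ≤ B) (c : Concept n)
    (st : Finset (Concept n) × ℕ) (hst : st ∈ (learner C c).support) :
    st.1.card = 1 ∧ st.2 ≤ Nat.log 2 C.card * (innerRounds C * B) := by
  obtain ⟨-, hne, p, hp, hq, hpk⟩ := mem_support_outerLoop hG hC hB c _ st hst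
  have hpC : 2 ^ p ≤ C.card := (Nat.le_mul_of_pos_right _ hne.card_pos).trans hp
  refine ⟨?_, hq.trans (Nat.mul_le_mul_right _ (Nat.le_log_of_pow_le (by norm_num) hpC))⟩
  rcases hpk with h | h
  · exact h
  · rw [h] at hpC
    exact absurd hpC (not_le.2 Nat.lt_two_pow_self)

theorem expect_outerLoop_failurePotential_le {G B : ℕ} {C : Finset (Concept n)}
    (hG : ∀ D ⊆ C, 2 ≤ D.card → ∃ x, D.card ≤ G * minority D x) {c : Concept n} (hc : c ∈ C)
    (hB : ∀ I : Finset (BitString n), I.card ≤ G → searchCost I ≤ B) (k : ℕ) :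
    expect (outerLoop C c k) (fun st => failurePotential c (2⁻¹ ^ innerRounds C) st.1) ≤
      2⁻¹ ^ innerRounds C * Nat.log 2 C.card := by
  induction k with
  | zero => rw [outerLoop, expect_pure, failurePotential, if_pos hc]
  | succ k ih =>
    rw [outerLoop, expect_bind]
    refine (expect_mono fun st hst => ?_).trans ih
    obtain ⟨h1, h2, -⟩ := mem_support_outerLoop hG ⟨c, hc⟩ hB c k st hst
    exact expect_outerStep_failurePotential_le hG c st h1 h2

theorem natLog_le_logb {k : ℕ} (hk : k ≠ 0) : (Nat.log 2 k : ℝ) ≤ Real.logb 2 k := by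
  rw [Real.le_logb_iff_rpow_le (by norm_num) (by positivity), Real.rpow_natCast]
  exact_mod_cast Nat.pow_log_le_self 2 hk

theorem three_mul_log_le_two_pow_innerRounds {C : Finset (Concept n)} (hC : 2 ≤ C.card) :
    3 * Nat.log 2 C.card ≤ 2 ^ innerRounds C := by
  have hL : 0 < Real.logb 2 C.card := Real.logb_pos (by norm_num) (by exact_mod_cast hC)
  have h1 : Real.logb 2 (3 * Real.logb 2 C.card) ≤ innerRounds C := Nat.le_ceil _
  rw [Real.logb_le_iff_le_rpow (by norm_num) (by positivity), Real.rpow_natCast] at h1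
  have h2 := natLog_le_logb (k := C.card) (by omega)
  have h3 : 3 * (Nat.log 2 C.card : ℝ) ≤ 2 ^ innerRounds C := by linarith
  exact_mod_cast h3

theorem two_thirds_le_learner {G B : ℕ} {C : Finset (Concept n)}
    (hG : ∀ D ⊆ C, 2 ≤ D.card → ∃ x, D.card ≤ G * minority D x) (hcard : 2 ≤ C.card)
    (hB : ∀ I : Finset (BitString n), I.card ≤ G → searchCost I ≤ B) {c : Concept n}
    (hc : c ∈ C) : 2 / 3 ≤ ((learner C c).map Prod.fst) {c} := by
  have hfail : expect (learner C c)
      (fun st => failurePotential c (2⁻¹ ^ innerRounds C) st.1) ≤ 3⁻¹ := by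
    refine (expect_outerLoop_failurePotential_le hG hc hB _).trans ?_
    have h : (3 : ℝ≥0∞) * Nat.log 2 C.card ≤ 2 ^ innerRounds C := by
      exact_mod_cast three_mul_log_le_two_pow_innerRounds hcard
    rw [← ENNReal.inv_pow, mul_comm, ← div_eq_mul_inv]
    refine ENNReal.div_le_of_le_mul ?_
    rw [← ENNReal.div_eq_inv_mul, ENNReal.le_div_iff_mul_le (by simp) (by simp), mul_comm]
    exact h
  have hsucc : expect (learner C c) (fun st => if st.1 = {c} then 1 else 0) =
      ((learner C c).map Prod.fst) {c} := by
    have h1 : expect (learner C c) (fun st => if st.1 = {c} then 1 else 0) =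
        expect ((learner C c).map Prod.fst) fun S => if S = {c} then 1 else 0 := by
      rw [expect_map]
      rfl
    rw [h1, expect, tsum_eq_single {c}]
    · simp
    · intro S hS
      simp [hS]
  have htotal : 1 ≤ ((learner C c).map Prod.fst) {c} + 3⁻¹ := by
    calc 1 = expect (learner C c) fun _ => 1 := (expect_const _ _).symm
      _ ≤ expect (learner C c) fun st => (if st.1 = {c} then 1 else 0) +
            failurePotential c (2⁻¹ ^ innerRounds C) st.1 := by
          refine expect_mono fun st hst => ?_
          obtain ⟨d, hd⟩ := Finset.card_eq_one.1 (mem_support_learner hG ⟨c, hc⟩ hB c st hst).1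
          by_cases hcd : c ∈ st.1
          · have : st.1 = {c} := by
              rw [hd, Finset.mem_singleton] at hcd
              rw [hd, hcd]
            rw [if_pos this]
            exact le_self_add
          · rw [failurePotential, if_neg hcd]
            exact le_add_self
      _ ≤ _ := by
          rw [expect_add, hsucc]
          gcongr
  have h23 : (2 / 3 : ℝ≥0∞) + 3⁻¹ = 1 := by
    rw [← one_div, ENNReal.div_add_div_same]
    norm_num
    exact ENNReal.div_self (by norm_num) (by norm_num)
  rw [← h23] at htotal
  exact (ENNReal.add_le_add_iff_right (by simp)).1 htotal

end Learner

/-! ### Comparison with the query complexity -/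

section Bounds

variable {n : ℕ}

theorem one_le_and_logb_card_le {C : Finset (Concept n)} {T : ℕ} (hn : 1 ≤ n) (hC : 2 ≤ C.card)
    {A : QuantumAlgorithm n} (hA : A.ExactlyLearns T C) :
    1 ≤ T ∧ Real.logb 2 C.card ≤ 3 * n * T := by
  have h1 := A.card_le_of_exactlyLearns hA
  have h2 : (2 : ℝ) ≤ C.card := by exact_mod_cast hC
  have hT : 1 ≤ T := by
    rcases Nat.eq_zero_or_pos T with h | h
    · subst h
      rw [pow_zero, Nat.cast_one] at h1
      linarith
    · exact h
  refine ⟨hT, ?_⟩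
  rw [Real.logb_le_iff_le_rpow (by norm_num) (by linarith)]
  have h3 : (C.card : ℝ) ≤ (2 : ℝ) ^ ((n + 1) * T + 1) := by
    rw [pow_succ, pow_mul]
    push_cast at h1
    have : (0 : ℝ) < (2 ^ (n + 1)) ^ T := by positivity
    linarith
  have h4 : (n + 1) * T + 1 ≤ 3 * n * T := by nlinarith
  calc (C.card : ℝ) ≤ (2 : ℝ) ^ ((n + 1) * T + 1) := h3
    _ ≤ (2 : ℝ) ^ (3 * n * T) := pow_le_pow_right₀ (by norm_num) h4
    _ = (2 : ℝ) ^ (3 * n * T : ℝ) := by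
      rw [← Real.rpow_natCast]
      push_cast
      rfl

theorem searchCost_le {T : ℕ} (hT : 1 ≤ T) {I : Finset (BitString n)}
    (hI : I.card ≤ 336 * T ^ 2) : searchCost I ≤ 87 * T := by
  have h : ceilSqrtCard I ≤ 19 * T := by
    rw [ceilSqrtCard, Nat.ceil_le]
    refine Real.sqrt_le_iff.2 ⟨by positivity, ?_⟩
    have h1 : I.card ≤ (19 * T) ^ 2 := by nlinarith
    exact_mod_cast h1
  rw [searchCost]
  omega

theorem innerRounds_le {C : Finset (Concept n)} (hC : 2 ≤ C.card) :
    (innerRounds C : ℝ) ≤ 4 * max 1 (Real.logb 2 (Real.logb 2 C.card)) := by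
  have hL : 1 ≤ Real.logb 2 C.card := by
    rw [Real.le_logb_iff_rpow_le (by norm_num) (by positivity), Real.rpow_one]
    exact_mod_cast hC
  have h3 : Real.logb 2 3 ≤ 2 := by
    rw [Real.logb_le_iff_le_rpow (by norm_num) (by norm_num)]
    norm_num
  have h30 : 0 ≤ Real.logb 2 3 := Real.logb_nonneg (by norm_num) (by norm_num)
  have hLL : 0 ≤ Real.logb 2 (Real.logb 2 C.card) := Real.logb_nonneg (by norm_num) hL
  have hsplit : Real.logb 2 (3 * Real.logb 2 C.card) =
      Real.logb 2 3 + Real.logb 2 (Real.logb 2 C.card) :=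
    Real.logb_mul (by norm_num) (by linarith)
  have h4 : (innerRounds C : ℝ) < Real.logb 2 (3 * Real.logb 2 C.card) + 1 := by
    refine Nat.ceil_lt_add_one ?_
    rw [hsplit]
    positivity
  have h5 := le_max_left 1 (Real.logb 2 (Real.logb 2 C.card))
  have h6 := le_max_right 1 (Real.logb 2 (Real.logb 2 C.card))
  linarith

theorem max_one_logb_logb_card_le {C : Finset (Concept n)} (hn : 1 ≤ n) (hC : 2 ≤ C.card) :
    max 1 (Real.logb 2 (Real.logb 2 C.card)) ≤ n := by
  refine max_le (by exact_mod_cast hn) ?_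
  have hL : 0 < Real.logb 2 C.card := Real.logb_pos (by norm_num) (by exact_mod_cast hC)
  have h1 : C.card ≤ 2 ^ 2 ^ n := by
    refine (Finset.card_le_univ C).trans (le_of_eq ?_)
    simp
  rw [Real.logb_le_iff_le_rpow (by norm_num) hL, Real.logb_le_iff_le_rpow (by norm_num)
    (by positivity), Real.rpow_natCast]
  have h2 : ((2 : ℝ) ^ n) = ((2 ^ n : ℕ) : ℝ) := by push_cast; rfl
  rw [h2, Real.rpow_natCast]
  exact_mod_cast h1

end Bounds

end QuantumLearning

theorem mainTheorem6 :
    ∃ K : ℝ, 0 < K ∧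
      ∀ (n : ℕ) (C : Finset (QuantumLearning.Concept n)), 1 ≤ n → 2 ≤ C.card →
        ∀ c ∈ C,
          -- the algorithm identifies the target with probability at least 2/3
          2 / 3 ≤ ((QuantumLearning.learner C c).map Prod.fst) {c} ∧
          -- every run ends with one candidate, and its number of queries is bounded
          ∀ out ∈ (QuantumLearning.learner C c).support,
            out.1.card = 1 ∧
            (out.2 : ℝ) ≤ K * n * (QuantumLearning.quantumQueryComplexity C : ℝ) ^ 2 *
              max 1 (Real.logb 2 (Real.logb 2 (C.card : ℝ))) ∧
            (out.2 : ℝ) ≤ K * (n : ℝ) ^ 2 *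
              (QuantumLearning.quantumQueryComplexity C : ℝ) ^ 2 := by
  -- `1044 = 3 * 4 * 87`: the factors of the bounds on the number of passes, on the repetitions
  -- of the search in a pass, and on the cost of a search
  refine ⟨1044, by norm_num, fun n C hn hC c hc => ?_⟩
  obtain ⟨A, hA⟩ := QuantumLearning.exists_exactlyLearns_quantumQueryComplexity C
  set T := QuantumLearning.quantumQueryComplexity C
  obtain ⟨hT, hlog⟩ := QuantumLearning.one_le_and_logb_card_le hn hC hA
  have hG : ∀ D ⊆ C, 2 ≤ D.card → ∃ x, D.card ≤ 336 * T ^ 2 * QuantumLearning.minority D x :=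
    fun D hD hD2 => A.exists_card_le_minority hA hD hD2
  have hB : ∀ I : Finset (QuantumLearning.BitString n), I.card ≤ 336 * T ^ 2 →
      QuantumLearning.searchCost I ≤ 87 * T := fun I hI => QuantumLearning.searchCost_le hT hI
  refine ⟨QuantumLearning.two_thirds_le_learner hG hC hB hc, fun out hout => ?_⟩
  obtain ⟨h1, h2⟩ := QuantumLearning.mem_support_learner hG ⟨c, hc⟩ hB c out hout
  have hlog' := (QuantumLearning.natLog_le_logb (k := C.card) (by omega)).trans hlog
  have hR := QuantumLearning.innerRounds_le hC
  have hM := QuantumLearning.max_one_logb_logb_card_le hn hC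
  set M := max 1 (Real.logb 2 (Real.logb 2 (C.card : ℝ)))
  have h3 : (out.2 : ℝ) ≤ 1044 * n * (T : ℝ) ^ 2 * M := by
    have h2' : (out.2 : ℝ) ≤
        Nat.log 2 C.card * (QuantumLearning.innerRounds C * (87 * T)) := by exact_mod_cast h2
    calc (out.2 : ℝ) ≤ Nat.log 2 C.card * (QuantumLearning.innerRounds C * (87 * T)) := h2'
      _ ≤ (3 * n * T) * (4 * M * (87 * T)) := by gcongr
      _ = _ := by ring
  refine ⟨h1, h3, h3.trans ?_⟩
  calc 1044 * n * (T : ℝ) ^ 2 * M ≤ 1044 * n * (T : ℝ) ^ 2 * n := by gcongr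
    _ = _ := by ring
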